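/- A \emph{real algebraic hypersurface of degree $d$} in $\mathbb{R}^n$ (a \emph{real algebraic curve} if $n=2$) is the real zero set $H$ of a polynomial $f\in\mathbb{R}[x_1,\dots,x_n]$ of degree $d$ that generates the ideal $I(H)$ of all real polynomials vanishing on $H$. The \emph{$\mathbb{R}$-degree} $\mathbb{R}\deg(H)$ of an algebraic set $H\subset\mathbb{R}^n$ is the supremum of the cardinality of $H\cap L$ over all lines $L\subset\mathbb{R}^n$ that meet $H$ transversally, that is, such that at every $p\in H\cap L$ the tangent space $T_pH=\{v : dg_p(v)=0 \text{ for all } g\in I(H)\}$ is a hyperplane not containing the direction of $L$. For a real algebraic curve $\Gamma=\{f=0\}\subset\mathbb{R}^2$, with $f$ generating $I(\Gamma)$, the \emph{evolute} $E_\Gamma\subset\mathbb{R}^2$ is the real algebraic set obtained as the Zariski closure of the set of centres of curvature \[ \left(x+\frac{f_x\,(f_x^2+f_y^2)}{D},\; y+\frac{f_y\,(f_x^2+f_y^2)}{D}\right),\qquad D=2f_xf_yf_{xy}-f_y^2f_{xx}-f_x^2f_{yy}, \] taken over all points $(x,y)\in\Gamma$ with $D(x,y)\neq 0$ (i.e.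 the smooth points of $\Gamma$ with nonzero curvature). \textbf{Proposition.} For every integer $d\ge 3$, the maximal $\mathbb{R}$-degree of the evolutes of real algebraic curves of degree $d$ is not less than $d(d-2)$: \[ \sup\{\mathbb{R}\deg(E_\Gamma) : \Gamma\subset\mathbb{R}^2 \text{ a real algebraic curve of degree } d\}\;\ge\; d(d-2). \] -/

import Mathlib

open MvPolynomial

/-- `f` is an equation of the real algebraic hypersurface `H ⊆ ℝⁿ`: `H` is the real zero set of
`f`, and `f` generates the ideal of all real polynomials vanishing on `H` (so `f` has no multiple
factors, and no factors whose real zero set is too small). Such an `f` is unique up to a nonzero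
constant factor. -/
def IsEquationOf {n : ℕ} (f : MvPolynomial (Fin n) ℝ) (H : Set (Fin n → ℝ)) : Prop :=
  H = {p | eval p f = 0} ∧ vanishingIdeal ℝ H = Ideal.span {f}

/-- `Γ ⊆ ℝ²` is a real algebraic curve of degree `d`. -/
def IsRealAlgebraicCurve (Γ : Set (Fin 2 → ℝ)) (d : ℕ) : Prop :=
  ∃ f : MvPolynomial (Fin 2) ℝ, IsEquationOf f Γ ∧ f.totalDegree = d

/-- The Zariski closure in `ℝⁿ` of a set of points. -/
def zariskiClosure {n : ℕ} (S : Set (Fin n → ℝ)) : Set (Fin n → ℝ) :=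
  zeroLocus ℝ (vanishingIdeal ℝ S)

/-- The (embedded, Zariski) tangent space at `p` of the algebraic set `H ⊆ ℝⁿ`: the common kernel
of the differentials at `p` of all polynomials vanishing on `H`. -/
def tangentSpaceAt {n : ℕ} (H : Set (Fin n → ℝ)) (p : Fin n → ℝ) : Submodule ℝ (Fin n → ℝ) where
  carrier := {v | ∀ g ∈ vanishingIdeal ℝ H, ∑ i, eval p (pderiv i g) * v i = 0}
  zero_mem' := fun g _ => by simp
  add_mem' := fun {v w} hv hw g hg => by
    simp only [Pi.add_apply, mul_add, Finset.sum_add_distrib]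
    rw [hv g hg, hw g hg, add_zero]
  smul_mem' := fun c v hv g hg => by
    have h := hv g hg
    simp only [Pi.smul_apply, smul_eq_mul, mul_left_comm _ c, ← Finset.mul_sum]
    rw [h, mul_zero]

/-- The line `L` meets the hypersurface `H` transversally: at every common point `p`, the tangent
space of `H` is a hyperplane (`H` is smooth at `p`) complementary to the direction of `L`. -/
def MeetsTransversally {n : ℕ} (L : AffineSubspace ℝ (Fin n → ℝ)) (H : Set (Fin n → ℝ)) : Prop :=
  ∀ p ∈ H ∩ (L : Set (Fin n → ℝ)), IsCompl (tangentSpaceAt H p) L.direction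

/-- The `ℝ`-degree of `H ⊆ ℝⁿ`: the supremum of the cardinality of `H ∩ L` over all lines `L`
meeting `H` transversally. -/
noncomputable def realDegree {n : ℕ} (H : Set (Fin n → ℝ)) : ℕ∞ :=
  ⨆ (L : AffineSubspace ℝ (Fin n → ℝ)) (_ : Module.finrank ℝ L.direction = 1)
    (_ : MeetsTransversally L H), (H ∩ (L : Set (Fin n → ℝ))).encard

/-- The value at `p` of `2 f_x f_y f_xy - f_y² f_xx - f_x² f_yy`. At a smooth point `p` of the curve
`f = 0` it vanishes exactly when the curvature of the curve at `p` vanishes. -/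
noncomputable def curvatureForm (f : MvPolynomial (Fin 2) ℝ) (p : Fin 2 → ℝ) : ℝ :=
  2 * eval p (pderiv 0 f) * eval p (pderiv 1 f) * eval p (pderiv 0 (pderiv 1 f))
    - eval p (pderiv 1 f) ^ 2 * eval p (pderiv 0 (pderiv 0 f))
    - eval p (pderiv 0 f) ^ 2 * eval p (pderiv 1 (pderiv 1 f))

/-- The centre of curvature at `p` of the curve `f = 0`, meaningful when `f p = 0`, the gradient of
`f` does not vanish at `p`, and `curvatureForm f p ≠ 0`. -/
noncomputable def curvatureCentre (f : MvPolynomial (Fin 2) ℝ) (p : Fin 2 → ℝ) : Fin 2 → ℝ :=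
  fun i => p i + eval p (pderiv i f) *
    (eval p (pderiv 0 f) ^ 2 + eval p (pderiv 1 f) ^ 2) / curvatureForm f p

/-- The set of centres of curvature of `Γ` at its smooth points of nonvanishing curvature.
(Replacing the equation `f` by a nonzero multiple `c f` does not change `curvatureCentre f p`;
`curvatureForm f p ≠ 0` implies that the gradient of `f` at `p` is nonzero.) -/
def curvatureCentres (Γ : Set (Fin 2 → ℝ)) : Set (Fin 2 → ℝ) :=
  {c | ∃ f, IsEquationOf f Γ ∧ ∃ p ∈ Γ, curvatureForm f p ≠ 0 ∧ c = curvatureCentre f p}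

/-- The evolute of `Γ`, as a real algebraic curve: the Zariski closure of the locus of centres of
curvature of `Γ`. -/
def evolute (Γ : Set (Fin 2 → ℝ)) : Set (Fin 2 → ℝ) :=
  zariskiClosure (curvatureCentres Γ)

/-- The maximal `ℝ`-degree of the evolutes of the real algebraic curves of degree `d`. -/
noncomputable def maxRealDegreeEvolute (d : ℕ) : ℕ∞ :=
  ⨆ (Γ : Set (Fin 2 → ℝ)) (_ : IsRealAlgebraicCurve Γ d), realDegree (evolute Γ)

/-! Take `d` lines in general position and smooth their nodes: `f = ∏ l_k - ε`, with `l_k` the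
tangent lines of slopes `1, ..., d` to a parabola. Near the node of `l_i` and `l_j` the curve
resembles a small hyperbola, and as `ε → 0` its evolute follows closely, over any fixed abscissa off
the node, the normals at the node to the two lines. There is thus one such normal for each ordered
pair `(i, j)`. A vertical line near `x = √2` meets the `d(d-1)` normals at distinct heights, hence
the evolute in at least `d(d-1) ≥ d(d-2)` points.

The local statement is `eventually_exists_curvatureCentre`. With `l_i = h²σ`, `l_j = hτ` and `ε =
h³`, the centre of curvature extends smoothly to `h = 0`, where it moves along the normal to `l_i`;
the open mapping form of the inverse function theorem (`map_nodeMap_nhds`) carries this to small `h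
≠ 0`, uniformly for abscissae near the given one.

Transversality comes from elimination. The centres of curvature satisfy a nonzero polynomial
(`vanishingIdeal_curvatureCentres_ne_bot`, by dimension counting), and then all but finitely many
vertical lines are transversal to their Zariski closure
(`finite_not_meetsTransversally_verticalLine`). Fixing `h` before the abscissa leaves infinitely
many lines to choose from. That `f` generates the ideal of its zero set follows from its having `d`
real roots in `y` for every `x ≤ 0` (`isEquationOf_perturbedLines`). -/

open scoped Topology

/-! ### Radical ideals of `K[X][Y]`, generically in `X` -/

section Elimination

open Polynomial

variable {K : Type*} [Field K]

theorem exists_C_mul_eq_map (p : (FractionRing K[X])[X]) :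
    ∃ c : K[X], c ≠ 0 ∧ ∃ q : K[X][X],
      q.map (algebraMap K[X] (FractionRing K[X])) = Polynomial.C (algebraMap _ _ c) * p := by
  obtain ⟨b, hbm, hb⟩ := IsLocalization.integerNormalization_spec (nonZeroDivisors K[X]) p
  refine ⟨b, nonZeroDivisors.ne_zero hbm, _, hb.trans ?_⟩
  rw [← Polynomial.smul_eq_C_mul]
  exact (algebraMap_smul (FractionRing K[X]) b p).symm

/-- A nonzero radical ideal of `K[X][Y]` is, up to inverting a nonzero polynomial in `X`, generated
by one polynomial that is separable in `Y`. -/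
theorem exists_generic_generator [CharZero K] (J : Ideal K[X][X]) (hJ : J.IsRadical)
    (hJ0 : J ≠ ⊥) :
    ∃ g ∈ J, ∃ r : K[X], r ≠ 0 ∧ (∃ a b, a * g + b * derivative g = Polynomial.C r) ∧
      ∀ h ∈ J, ∃ (k : ℕ) (q : K[X][X]), Polynomial.C r ^ k * h = q * g := by
  classical
  obtain ⟨g₀, hg₀, hg₀0⟩ := Submodule.exists_mem_ne_zero_of_ne_bot hJ0
  have hex : ∃ n, ∃ g ∈ J, g ≠ 0 ∧ g.natDegree = n := ⟨_, g₀, hg₀, hg₀0, rfl⟩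
  obtain ⟨g, hgJ, hg0, hgn⟩ := Nat.find_spec hex
  have hmin : ∀ h ∈ J, h.natDegree < g.natDegree → h = 0 := by
    intro h hh hlt
    by_contra h0
    exact Nat.find_min hex (hgn ▸ hlt) ⟨h, hh, h0, rfl⟩
  -- Pseudo-division by `g`, an element of least `Y`-degree: the remainder stays in `J` and has
  -- smaller degree, so it is zero.
  have hdiv : ∀ n, ∀ h ∈ J, h.natDegree ≤ n → ∃ (k : ℕ) (q : K[X][X]),
      Polynomial.C g.leadingCoeff ^ k * h = q * g := by
    intro n
    induction n using Nat.strong_induction_on with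
    | _ n ih =>
      intro h hh hn
      rcases lt_or_ge h.natDegree g.natDegree with hlt | hle
      · exact ⟨0, 0, by simp [hmin h hh hlt]⟩
      -- `cancelLeads` lowers the degree only when it is positive; otherwise `g` is constant in `Y`
      -- and equals its leading coefficient.
      rcases Nat.eq_zero_or_pos h.natDegree with hz | hpos
      · have hgz : g.natDegree = 0 := by omega
        refine ⟨1, h, ?_⟩
        rw [Polynomial.eq_C_of_natDegree_eq_zero hgz]
        simp [mul_comm]
      have hlt := Polynomial.natDegree_cancelLeads_lt_of_natDegree_le_natDegree hle hpos
      have hmem : g.cancelLeads h ∈ J := by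
        unfold Polynomial.cancelLeads
        exact J.sub_mem (J.mul_mem_left _ hh) (J.mul_mem_left _ hgJ)
      obtain ⟨k, q, hq⟩ := ih _ (lt_of_lt_of_le hlt hn) _ hmem le_rfl
      refine ⟨k + 1, q + Polynomial.C g.leadingCoeff ^ k * (Polynomial.C h.leadingCoeff *
        Polynomial.X ^ (h.natDegree - g.natDegree)), ?_⟩
      unfold Polynomial.cancelLeads at hq
      rw [Nat.sub_eq_zero_of_le hle, pow_zero, mul_one] at hq
      rw [pow_succ]
      linear_combination hq
  set φ := algebraMap K[X] (FractionRing K[X]) with hφ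
  have hφi : Function.Injective φ := IsFractionRing.injective _ _
  have hmapi : Function.Injective (Polynomial.map φ) := Polynomial.map_injective φ hφi
  -- If `g = a²b` over the fraction field, then `(ab)²` is a multiple of `g`, so radicality puts a
  -- cleared form of `ab` in `J`; minimality of the degree of `g` forces `a` to be constant.
  have hsq : Squarefree (g.map φ) := by
    rintro a ⟨b, hb⟩
    have hab0 : a * a * b ≠ 0 := by
      rw [← hb]; exact (Polynomial.map_ne_zero_iff hφi).2 hg0
    have ha0 : a ≠ 0 := by rintro rfl; simp at hab0
    have hb0 : b ≠ 0 := by rintro rfl; simp at hab0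
    obtain ⟨c, hc, h, hh⟩ := exists_C_mul_eq_map (a * b)
    obtain ⟨c', hc', b', hb'⟩ := exists_C_mul_eq_map b
    have hfin : Polynomial.C c' * h ^ 2 = Polynomial.C c ^ 2 * b' * g := by
      apply hmapi
      simp only [Polynomial.map_mul, Polynomial.map_pow, Polynomial.map_C]
      rw [← hφ] at hh hb'
      rw [hh, hb', hb]
      ring
    have hmem : Polynomial.C c' * h ∈ J := by
      refine hJ ⟨2, ?_⟩
      have : (Polynomial.C c' * h) ^ 2 = Polynomial.C c' * (Polynomial.C c ^ 2 * b') * g := by linear_combination Polynomial.C c' * hfin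
      rw [this]
      exact J.mul_mem_left _ hgJ
    have hdegh : h.natDegree = (a * b).natDegree := by
      rw [← Polynomial.natDegree_map_eq_of_injective hφi h, hh]
      exact Polynomial.natDegree_C_mul ((map_ne_zero_iff _ hφi).2 hc)
    have hdegg : g.natDegree = a.natDegree + (a * b).natDegree := by
      rw [← Polynomial.natDegree_map_eq_of_injective hφi g, hb, mul_assoc,
        Polynomial.natDegree_mul ha0 (mul_ne_zero ha0 hb0)]
    by_contra hu
    have hapos : 0 < a.natDegree := by
      rw [Nat.pos_iff_ne_zero]
      intro h0
      apply hu
      rw [Polynomial.isUnit_iff_degree_eq_zero, Polynomial.degree_eq_natDegree ha0, h0]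
      rfl
    have h0 := hmin _ hmem (by rw [Polynomial.natDegree_C_mul hc']; omega)
    have hh0 : h = 0 := by simpa [hc'] using h0
    rw [hh0, Polynomial.map_zero, eq_comm] at hh
    simp only [mul_eq_zero, Polynomial.C_eq_zero, ha0, hb0, or_false] at hh
    exact hc (hφi (hh.trans (map_zero _).symm))
  have hsep : (g.map φ).Separable := PerfectField.separable_iff_squarefree.2 hsq
  obtain ⟨a, b, hab⟩ := hsep
  obtain ⟨c, hc, a', ha'⟩ := exists_C_mul_eq_map a
  obtain ⟨c', hc', b', hb'⟩ := exists_C_mul_eq_map b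
  have hlc : g.leadingCoeff ≠ 0 := Polynomial.leadingCoeff_ne_zero.2 hg0
  -- `c * c'` clears the denominators of the Bézout identity, and the leading coefficient serves the
  -- pseudo-division.
  refine ⟨g, hgJ, c * c' * g.leadingCoeff, mul_ne_zero (mul_ne_zero hc hc') hlc,
    ⟨Polynomial.C g.leadingCoeff * (Polynomial.C c' * a'), Polynomial.C g.leadingCoeff * (Polynomial.C c * b'), ?_⟩, ?_⟩
  · apply hmapi
    rw [← hφ] at ha' hb'
    simp only [Polynomial.map_mul, Polynomial.map_C, Polynomial.map_add, ha', hb',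
      ← Polynomial.derivative_map, map_mul]
    linear_combination (Polynomial.C (φ g.leadingCoeff) * Polynomial.C (φ c) * Polynomial.C (φ c')) * hab
  · intro h hh
    obtain ⟨k, q, hq⟩ := hdiv _ h hh le_rfl
    refine ⟨k, (Polynomial.C c * Polynomial.C c') ^ k * q, ?_⟩
    rw [map_mul, map_mul, mul_pow]
    linear_combination (Polynomial.C c * Polynomial.C c') ^ k * hq

end Elimination

/-! ### Vertical lines and transversality -/

theorem eval_equivMvPolynomial (g : Polynomial (Polynomial ℝ)) (p : Fin 2 → ℝ) :
    eval p (Polynomial.Bivariate.equivMvPolynomial ℝ g) = g.evalEval (p 0) (p 1) := by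
  have : (MvPolynomial.aeval p).comp
      (Polynomial.Bivariate.equivMvPolynomial ℝ).toAlgHom =
        Polynomial.aevalAeval (p 0) (p 1) := by
    apply (Polynomial.aevalAevalEquiv ℝ ℝ).symm.injective
    simp [Polynomial.aevalAevalEquiv]
  have h := DFunLike.congr_fun this g
  rw [Polynomial.coe_aevalAeval_eq_evalEval] at h
  rw [← h]
  simp [MvPolynomial.aeval_eq_eval]

theorem vanishingIdeal_isRadical {n : ℕ} (S : Set (Fin n → ℝ)) :
    (vanishingIdeal ℝ S).IsRadical := by
  rintro f ⟨k, hk⟩ x hx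
  have := hk x hx
  rw [map_pow] at this
  exact eq_zero_of_pow_eq_zero this

theorem vanishingIdeal_zariskiClosure {n : ℕ} (S : Set (Fin n → ℝ)) :
    vanishingIdeal ℝ (zariskiClosure S) = vanishingIdeal ℝ S :=
  zeroLocus_vanishingIdeal_galoisConnection.u_l_u_eq_u S

/-- The line `x = c` in the plane. -/
def verticalLine (c : ℝ) : AffineSubspace ℝ (Fin 2 → ℝ) :=
  AffineSubspace.mk' ![c, 0] (Submodule.span ℝ {![0, 1]})

theorem mem_verticalLine {c : ℝ} {p : Fin 2 → ℝ} : p ∈ verticalLine c ↔ p 0 = c := by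
  rw [verticalLine, AffineSubspace.mem_mk', Submodule.mem_span_singleton]
  constructor
  · rintro ⟨a, ha⟩
    have := congrFun ha 0
    simp at this
    linarith
  · intro h
    refine ⟨p 1, ?_⟩
    ext i
    fin_cases i <;> simp [h]

theorem direction_verticalLine (c : ℝ) :
    (verticalLine c).direction = Submodule.span ℝ {![0, 1]} :=
  AffineSubspace.direction_mk' _ _

theorem finrank_direction_verticalLine (c : ℝ) :
    Module.finrank ℝ (verticalLine c).direction = 1 := by
  rw [direction_verticalLine]
  refine finrank_span_singleton fun h => ?_
  simpa using congrFun h 1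

/-- All but finitely many vertical lines are transversal to the Zariski closure of a set on which
some nonzero polynomial vanishes. -/
theorem finite_not_meetsTransversally_verticalLine (S : Set (Fin 2 → ℝ))
    (hS : vanishingIdeal ℝ S ≠ ⊥) :
    {c : ℝ | ¬ MeetsTransversally (verticalLine c) (zariskiClosure S)}.Finite := by
  set e := Polynomial.Bivariate.equivMvPolynomial ℝ with he
  set J : Ideal (Polynomial (Polynomial ℝ)) := (vanishingIdeal ℝ S).comap e with hJ
  have hJr : J.IsRadical := (vanishingIdeal_isRadical S).comap _
  have hJ0 : J ≠ ⊥ := by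
    intro h0
    obtain ⟨f, hf, hf0⟩ := Submodule.exists_mem_ne_zero_of_ne_bot hS
    have : e.symm f ∈ J := by simpa [hJ, Ideal.mem_comap] using hf
    rw [h0, Ideal.mem_bot] at this
    exact hf0 (by simpa using this)
  obtain ⟨g, hgJ, r, hr0, ⟨a, b, hab⟩, hdiv⟩ := exists_generic_generator J hJr hJ0
  refine (Polynomial.finite_setOfPred_isRoot hr0).subset ?_
  intro c hc
  by_contra hrc
  rw [Set.mem_ofPred_eq, Polynomial.IsRoot.def] at hrc
  apply hc
  rintro p ⟨hpE, hpL⟩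
  have hp0 : p 0 = c := mem_verticalLine.1 hpL
  have hvan : ∀ h ∈ J, h.evalEval (p 0) (p 1) = 0 := by
    intro h hh
    rw [← eval_equivMvPolynomial]
    exact hpE _ hh
  -- Evaluate the Bézout identity at `p`: `g` vanishes there and `r` does not.
  have hgy : eval p (pderiv 1 (e g)) ≠ 0 := by
    rw [he, Polynomial.Bivariate.pderiv_one_equivMvPolynomial, eval_equivMvPolynomial]
    intro h0
    have := congrArg (Polynomial.evalEval (p 0) (p 1)) hab
    rw [Polynomial.evalEval_add, Polynomial.evalEval_mul, Polynomial.evalEval_mul, hvan g hgJ, h0,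
      Polynomial.evalEval_C, hp0] at this
    simp only [mul_zero, add_zero] at this
    exact hrc this.symm
  have hgE : eval p (e g) = 0 := hpE _ hgJ
  have hT : ∀ v : Fin 2 → ℝ, v ∈ tangentSpaceAt (zariskiClosure S) p ↔
      eval p (pderiv 0 (e g)) * v 0 + eval p (pderiv 1 (e g)) * v 1 = 0 := by
    intro v
    change (∀ h ∈ vanishingIdeal ℝ (zariskiClosure S), _) ↔ _
    rw [vanishingIdeal_zariskiClosure]
    constructor
    · intro h
      have := h (e g) hgJ
      rwa [Fin.sum_univ_two] at this
    · intro hv h hh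
      rw [Fin.sum_univ_two]
      have hhJ : e.symm h ∈ J := by simpa [hJ, Ideal.mem_comap] using hh
      obtain ⟨k, q, hq⟩ := hdiv _ hhJ
      have hhE : eval p h = 0 := hpE _ hh
      have hq' : e (Polynomial.C r) ^ k * h = e q * e g := by
        have := congrArg e hq
        simpa using this
      have hrE : eval p (e (Polynomial.C r)) ≠ 0 := by
        rw [he, eval_equivMvPolynomial, Polynomial.evalEval_C, hp0]
        exact hrc
      -- Differentiating `r ^ k * h = q * g` at a common zero of `g` and `h` makes `dh` a multiple
      -- of `dg`; the tangent space is therefore the kernel of `dg`.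
      have hd : ∀ i, eval p (e (Polynomial.C r)) ^ k * eval p (pderiv i h) =
          eval p (e q) * eval p (pderiv i (e g)) := by
        intro i
        have := congrArg (fun m => eval p (pderiv i m)) hq'
        simpa [Derivation.leibniz, hhE, hgE] using this
      have hz : eval p (e (Polynomial.C r)) ^ k *
          (eval p (pderiv 0 h) * v 0 + eval p (pderiv 1 h) * v 1) = 0 := by
        linear_combination v 0 * hd 0 + v 1 * hd 1 + eval p (e q) * hv
      exact (mul_eq_zero.1 hz).resolve_left (pow_ne_zero _ hrE)
  rw [direction_verticalLine]
  constructor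
  · rw [Submodule.disjoint_def]
    intro v hv hv'
    obtain ⟨t, rfl⟩ := Submodule.mem_span_singleton.1 hv'
    have := (hT _).1 hv
    have ht : t = 0 := by simpa [hgy] using this
    simp [ht]
  · rw [codisjoint_iff, eq_top_iff]
    intro v _
    rw [Submodule.mem_sup]
    set t := (eval p (pderiv 0 (e g)) * v 0 + eval p (pderiv 1 (e g)) * v 1) /
      eval p (pderiv 1 (e g)) with ht
    refine ⟨v - t • ![0, 1], ?_, t • ![0, 1],
      Submodule.smul_mem _ _ (Submodule.mem_span_singleton_self _), sub_add_cancel _ _⟩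
    rw [hT]
    simp only [Pi.sub_apply, Pi.smul_apply, smul_eq_mul, Matrix.cons_val_zero, Matrix.cons_val_one,
      ht]
    field_simp
    ring

/-! ### Algebraic dependence of rational functions on a plane curve -/

section Counting

variable {T : Type*} (x y : T → ℝ) (d K : ℕ)

/-- The span of the functions `x ^ i * y ^ j` with `i ≤ K * M` and `j < d`. -/
def monomialSpan (M : ℕ) : Submodule ℝ (T → ℝ) :=
  Submodule.span ℝ (Set.range fun ij : Fin (K * M + 1) × Fin d =>
    x ^ (ij.1 : ℕ) * y ^ (ij.2 : ℕ))

variable {x y d K}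

theorem mem_monomialSpan {M i j : ℕ} (hi : i ≤ K * M) (hj : j < d) :
    x ^ i * y ^ j ∈ monomialSpan x y d K M :=
  Submodule.subset_span ⟨(⟨i, by omega⟩, ⟨j, hj⟩), rfl⟩

theorem monomialSpan_mul_mem {M N : ℕ} {c : T → ℝ}
    (h : ∀ i j, i ≤ K * M → j < d → c * (x ^ i * y ^ j) ∈ monomialSpan x y d K N)
    {w : T → ℝ} (hw : w ∈ monomialSpan x y d K M) : c * w ∈ monomialSpan x y d K N := by
  have : monomialSpan x y d K M ≤ (monomialSpan x y d K N).comap (LinearMap.mulLeft ℝ c) := by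
    rw [monomialSpan, Submodule.span_le]
    rintro _ ⟨⟨i, j⟩, rfl⟩
    exact h i j (by omega) j.2
  exact this hw

theorem monomialSpan_mono {M N : ℕ} (h : M ≤ N) :
    monomialSpan x y d K M ≤ monomialSpan x y d K N := by
  intro w hw
  rw [← one_mul w]
  refine monomialSpan_mul_mem (fun i j hi hj => ?_) hw
  rw [one_mul]
  exact mem_monomialSpan (hi.trans (Nat.mul_le_mul_left K h)) hj

/-- The relation for `y ^ d` rewrites any overflow in `y` at the cost of at most `K` powers of `x`,
so multiplication by `x` or by `y` raises the level by at most one. The shift `m` depends on `h`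
alone, which makes the dimension count linear. -/
theorem exists_aeval_mul_mem_monomialSpan (hK : 1 ≤ K) (hrel : y ^ d ∈ monomialSpan x y d K 1)
    (h : MvPolynomial (Fin 2) ℝ) :
    ∃ m, ∀ M, ∀ w ∈ monomialSpan x y d K M,
      aeval ![x, y] h * w ∈ monomialSpan x y d K (M + m) := by
  have hX : ∀ M, ∀ w ∈ monomialSpan x y d K M, x * w ∈ monomialSpan x y d K (M + 1) := by
    intro M w hw
    refine monomialSpan_mul_mem (fun i j hi hj => ?_) hw
    rw [← mul_assoc, ← pow_succ']
    exact mem_monomialSpan (by rw [mul_add]; omega) hj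
  have hY : ∀ M, ∀ w ∈ monomialSpan x y d K M, y * w ∈ monomialSpan x y d K (M + 1) := by
    intro M w hw
    refine monomialSpan_mul_mem (fun i j hi hj => ?_) hw
    rw [mul_left_comm, ← pow_succ']
    rcases Nat.lt_or_ge (j + 1) d with hj' | hj'
    · exact mem_monomialSpan (by rw [mul_add]; omega) hj'
    · rw [show j + 1 = d by omega]
      refine monomialSpan_mul_mem (fun i' j' hi' hj' => ?_) hrel
      rw [← mul_assoc, ← pow_add]
      exact mem_monomialSpan (by rw [mul_add]; omega) hj'
  induction h using MvPolynomial.induction_on with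
  | C a =>
    refine ⟨0, fun M w hw => ?_⟩
    rw [MvPolynomial.aeval_C, ← Algebra.smul_def]
    exact Submodule.smul_mem _ _ hw
  | add p q hp hq =>
    obtain ⟨m, hm⟩ := hp
    obtain ⟨n, hn⟩ := hq
    refine ⟨m + n, fun M w hw => ?_⟩
    rw [map_add, add_mul]
    exact Submodule.add_mem _ (monomialSpan_mono (by omega) (hm M w hw))
      (monomialSpan_mono (by omega) (hn M w hw))
  | mul_X p i hp =>
    obtain ⟨m, hm⟩ := hp
    refine ⟨m + 1, fun M w hw => ?_⟩
    rw [map_mul, aeval_X, mul_assoc, mul_left_comm]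
    fin_cases i
    · exact hX _ _ (hm M w hw)
    · exact hY _ _ (hm M w hw)

theorem aeval_pow_mul_mem_monomialSpan {h : MvPolynomial (Fin 2) ℝ} {m : ℕ}
    (hm : ∀ M, ∀ w ∈ monomialSpan x y d K M,
      aeval ![x, y] h * w ∈ monomialSpan x y d K (M + m)) (n M : ℕ) {w : T → ℝ}
    (hw : w ∈ monomialSpan x y d K M) :
    aeval ![x, y] h ^ n * w ∈ monomialSpan x y d K (M + n * m) := by
  induction n with
  | zero => simpa using hw
  | succ n ih =>
    rw [pow_succ', mul_assoc, Nat.succ_mul, ← add_assoc]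
    exact hm _ _ ih

theorem finrank_monomialSpan_le (M : ℕ) :
    Module.finrank ℝ (monomialSpan x y d K M) ≤ (K * M + 1) * d := by
  refine (finrank_range_le_card _).trans ?_
  simp

instance (M : ℕ) : FiniteDimensional ℝ (monomialSpan x y d K M) :=
  FiniteDimensional.span_of_finite ℝ (Set.finite_range _)

/-- Two rational functions on a plane curve are algebraically dependent. -/
theorem exists_relation_of_mem_monomialSpan (hd : 1 ≤ d) (hK : 1 ≤ K)
    (hrel : y ^ d ∈ monomialSpan x y d K 1) (U V D : MvPolynomial (Fin 2) ℝ) :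
    ∃ G : MvPolynomial (Fin 2) ℝ, G ≠ 0 ∧ ∀ t, eval ![x t, y t] D ≠ 0 →
      eval ![eval ![x t, y t] U / eval ![x t, y t] D, eval ![x t, y t] V / eval ![x t, y t] D] G
        = 0 := by
  obtain ⟨m₁, h₁⟩ := exists_aeval_mul_mem_monomialSpan hK hrel U
  obtain ⟨m₂, h₂⟩ := exists_aeval_mul_mem_monomialSpan hK hrel V
  obtain ⟨m₃, h₃⟩ := exists_aeval_mul_mem_monomialSpan hK hrel D
  have weaken : ∀ {h : MvPolynomial (Fin 2) ℝ} {m : ℕ} (m' : ℕ), m ≤ m' →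
      (∀ M, ∀ w ∈ monomialSpan x y d K M,
        aeval ![x, y] h * w ∈ monomialSpan x y d K (M + m)) →
      (∀ M, ∀ w ∈ monomialSpan x y d K M,
        aeval ![x, y] h * w ∈ monomialSpan x y d K (M + m')) :=
    fun m' hmm h M w hw => monomialSpan_mono (by omega) (h M w hw)
  set m := m₁ + m₂ + m₃ with hm
  replace h₁ := weaken m (by omega) h₁
  replace h₂ := weaken m (by omega) h₂
  replace h₃ := weaken m (by omega) h₃
  -- The `N²` products `U^a V^b D^(2N-a-b)` lie in a space of dimension at most `(2NmK + 1)d`, which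
  -- this `N` makes smaller than `N²`. Division by `D^(2N)` turns a linear dependence into a
  -- polynomial relation between `U/D` and `V/D`.
  obtain ⟨N, hN⟩ : ∃ N, N = 2 * m * K * d + d + 1 := ⟨_, rfl⟩
  have h1 : (1 : T → ℝ) ∈ monomialSpan x y d K 0 := by
    simpa using mem_monomialSpan (x := x) (y := y) (K := K) (M := 0) (i := 0) (j := 0)
      (Nat.zero_le _) hd
  have hmem : ∀ ab : Fin N × Fin N, aeval ![x, y] U ^ (ab.1 : ℕ) * (aeval ![x, y] V ^ (ab.2 : ℕ) *
      (aeval ![x, y] D ^ (2 * N - ab.1 - ab.2) * 1)) ∈ monomialSpan x y d K (2 * N * m) := by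
    rintro ⟨a, b⟩
    have := aeval_pow_mul_mem_monomialSpan h₁ a _ (aeval_pow_mul_mem_monomialSpan h₂ b _
      (aeval_pow_mul_mem_monomialSpan h₃ (2 * N - a - b) _ h1))
    refine monomialSpan_mono (le_of_eq ?_) this
    rw [zero_add, ← add_mul, ← add_mul]
    congr 1
    omega
  have hdep : ¬ LinearIndependent ℝ (fun ab : Fin N × Fin N =>
      (⟨_, hmem ab⟩ : monomialSpan x y d K (2 * N * m))) := by
    intro hli
    have hle := hli.fintype_card_le_finrank.trans (finrank_monomialSpan_le _)
    simp only [Fintype.card_prod, Fintype.card_fin] at hle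
    have : (K * (2 * N * m) + 1) * d = N * (2 * m * K * d) + d := by ring
    rw [this] at hle
    have h2 : N * N = N * (2 * m * K * d) + N * (d + 1) := by
      nth_rewrite 2 [hN]
      ring
    have h3 : d + 1 ≤ N * (d + 1) := Nat.le_mul_of_pos_left _ (by omega)
    omega
  obtain ⟨c, hc, ⟨ab₀, hab₀⟩⟩ := Fintype.not_linearIndependent_iff.1 hdep
  replace hc := congrArg Subtype.val hc
  simp only [Submodule.coe_sum, Submodule.coe_smul, ZeroMemClass.coe_zero] at hc
  refine ⟨∑ ab : Fin N × Fin N,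
    monomial (Finsupp.single 0 (ab.1 : ℕ) + Finsupp.single 1 (ab.2 : ℕ)) (c ab), ?_, ?_⟩
  · intro h0
    have := congrArg (coeff (Finsupp.single 0 (ab₀.1 : ℕ) + Finsupp.single 1 (ab₀.2 : ℕ))) h0
    rw [coeff_sum, Finset.sum_eq_single ab₀, coeff_monomial, if_pos rfl, coeff_zero] at this
    · exact hab₀ this
    · intro ab _ hne
      rw [coeff_monomial, if_neg]
      intro heq
      apply hne
      have e0 := DFunLike.congr_fun heq 0
      have e1 := DFunLike.congr_fun heq 1
      simp at e0 e1
      exact Prod.ext (Fin.ext e0) (Fin.ext e1)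
    · simp
  · intro t ht
    have hev : ∀ h : MvPolynomial (Fin 2) ℝ, (aeval ![x, y] h : T → ℝ) t = eval ![x t, y t] h := by
      intro h
      have : (Pi.evalAlgHom ℝ (fun _ : T => ℝ) t).comp (aeval ![x, y]) =
          aeval ![x t, y t] := by
        apply MvPolynomial.algHom_ext
        intro i
        fin_cases i <;> simp
      have h' := DFunLike.congr_fun this h
      simpa [MvPolynomial.aeval_eq_eval] using h'
    have hct := congrFun hc t
    simp only [Finset.sum_apply, Pi.smul_apply, Pi.mul_apply, Pi.pow_apply, hev, smul_eq_mul,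
      mul_one, Pi.zero_apply] at hct
    have key : eval ![x t, y t] D ^ (2 * N) * eval ![eval ![x t, y t] U / eval ![x t, y t] D,
        eval ![x t, y t] V / eval ![x t, y t] D] (∑ ab : Fin N × Fin N,
          monomial (Finsupp.single 0 (ab.1 : ℕ) + Finsupp.single 1 (ab.2 : ℕ)) (c ab)) = 0 := by
      rw [← hct, map_sum, Finset.mul_sum]
      refine Finset.sum_congr rfl fun ab _ => ?_
      obtain ⟨n, hn⟩ : ∃ n, 2 * N - ab.1 - ab.2 = n := ⟨_, rfl⟩
      rw [hn, show 2 * N = n + ab.1 + ab.2 by omega]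
      rw [eval_monomial, Finsupp.prod_add_index' (by simp) (by intros; rw [pow_add]),
        Finsupp.prod_single_index (by simp), Finsupp.prod_single_index (by simp)]
      simp only [Matrix.cons_val_zero, Matrix.cons_val_one, div_pow]
      field_simp
      ring
    exact (mul_eq_zero.1 key).resolve_left (pow_ne_zero _ ht)

end Counting

open Polynomial.Bivariate in
/-- Two rational functions on a plane curve that is monic in the second variable are algebraically
dependent. -/
theorem exists_relation_of_monic {g : Polynomial (Polynomial ℝ)} (hg : g.Monic)
    (hd : 1 ≤ g.natDegree) (U V D : MvPolynomial (Fin 2) ℝ) :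
    ∃ G : MvPolynomial (Fin 2) ℝ, G ≠ 0 ∧ ∀ p, eval p (equivMvPolynomial ℝ g) = 0 →
      eval p D ≠ 0 → eval ![eval p U / eval p D, eval p V / eval p D] G = 0 := by
  let T := {p : Fin 2 → ℝ // eval p (equivMvPolynomial ℝ g) = 0}
  let x : T → ℝ := fun p => p.1 0
  let y : T → ℝ := fun p => p.1 1
  -- `K` exceeds the `X`-degree of every non-leading coefficient, so `g = 0` expresses `y ^ d` at
  -- level one.
  set K := (Finset.range g.natDegree).sup (fun j => (g.coeff j).natDegree) + 1 with hK
  have hrel : y ^ g.natDegree ∈ monomialSpan x y g.natDegree K 1 := by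
    have : y ^ g.natDegree = -∑ j ∈ Finset.range g.natDegree,
        ∑ i ∈ Finset.range K, (g.coeff j).coeff i • (x ^ i * y ^ j) := by
      ext p
      have hp := p.2
      rw [eval_equivMvPolynomial, ← Polynomial.eval₂_evalRingHom, Polynomial.eval₂_eq_sum_range,
        Finset.sum_range_succ, hg.coeff_natDegree, map_one, one_mul] at hp
      simp only [Pi.pow_apply, Pi.neg_apply, Finset.sum_apply, Pi.smul_apply, Pi.mul_apply,
        smul_eq_mul]
      change p.1 1 ^ _ = _
      rw [eq_neg_of_add_eq_zero_right hp]
      congr 1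
      refine Finset.sum_congr rfl fun j hj => ?_
      rw [Polynomial.coe_evalRingHom, Polynomial.eval_eq_sum_range' (n := K), Finset.sum_mul]
      · exact Finset.sum_congr rfl fun i _ => mul_assoc _ _ _
      · exact Nat.lt_succ_of_le
          (Finset.le_sup (f := fun j => (g.coeff j).natDegree) hj)
    rw [this]
    refine Submodule.neg_mem _ (Submodule.sum_mem _ fun j hj => Submodule.sum_mem _ fun i hi =>
      Submodule.smul_mem _ _ (mem_monomialSpan ?_ (Finset.mem_range.1 hj)))
    have := Finset.mem_range.1 hi
    omega
  obtain ⟨G, hG0, hG⟩ := exists_relation_of_mem_monomialSpan hd (by omega) hrel U V D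
  refine ⟨G, hG0, fun p hp hD => ?_⟩
  have hpe : ![p 0, p 1] = p := by ext i; fin_cases i <;> rfl
  have := hG ⟨p, hp⟩
  change eval ![p 0, p 1] D ≠ 0 → eval ![eval ![p 0, p 1] U / _, _] G = 0 at this
  rw [hpe] at this
  exact this hD

/-! ### An algebraic equation for the centres of curvature -/

theorem IsEquationOf.exists_eq_C_mul {n : ℕ} {f f' : MvPolynomial (Fin n) ℝ}
    {H : Set (Fin n → ℝ)} (hf : IsEquationOf f H) (hf' : IsEquationOf f' H) :
    ∃ c : ℝ, c ≠ 0 ∧ f' = C c * f := by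
  have hs : Ideal.span {f} = Ideal.span {f'} := hf.2.symm.trans hf'.2
  obtain ⟨u, hu⟩ := Ideal.span_singleton_eq_span_singleton.1 hs
  obtain ⟨c, hc, hcu⟩ := MvPolynomial.isUnit_iff_eq_C_of_isReduced.1 u.isUnit
  exact ⟨c, hc.ne_zero, by rw [← hu, ← hcu, mul_comm]⟩

theorem curvatureForm_C_mul (c : ℝ) (f : MvPolynomial (Fin 2) ℝ) (p : Fin 2 → ℝ) :
    curvatureForm (C c * f) p = c ^ 3 * curvatureForm f p := by
  simp only [curvatureForm, pderiv_C_mul, map_mul, eval_C]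
  ring

theorem curvatureCentre_C_mul {c : ℝ} (hc : c ≠ 0) (f : MvPolynomial (Fin 2) ℝ) (p : Fin 2 → ℝ) :
    curvatureCentre (C c * f) p = curvatureCentre f p := by
  ext i
  simp only [curvatureCentre, curvatureForm_C_mul, pderiv_C_mul, map_mul, eval_C]
  congr 1
  rw [← mul_div_mul_left _ (curvatureForm f p) (pow_ne_zero 3 hc)]
  ring

open Polynomial.Bivariate in
theorem vanishingIdeal_curvatureCentres_ne_bot {g : Polynomial (Polynomial ℝ)} (hg : g.Monic)
    (hd : 1 ≤ g.natDegree) {Γ : Set (Fin 2 → ℝ)}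
    (hΓ : IsEquationOf (equivMvPolynomial ℝ g) Γ) :
    vanishingIdeal ℝ (curvatureCentres Γ) ≠ ⊥ := by
  set f := equivMvPolynomial ℝ g with hf
  set D : MvPolynomial (Fin 2) ℝ := 2 * pderiv 0 f * pderiv 1 f * pderiv 0 (pderiv 1 f)
    - pderiv 1 f ^ 2 * pderiv 0 (pderiv 0 f) - pderiv 0 f ^ 2 * pderiv 1 (pderiv 1 f) with hD
  have hDe : ∀ p, eval p D = curvatureForm f p := by
    intro p
    simp [hD, curvatureForm]
  -- Numerators of the coordinates of the centre of curvature over the common denominator `D`.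
  let U : Fin 2 → MvPolynomial (Fin 2) ℝ := fun i =>
    X i * D + pderiv i f * (pderiv 0 f ^ 2 + pderiv 1 f ^ 2)
  obtain ⟨G, hG0, hG⟩ := exists_relation_of_monic hg hd (U 0) (U 1) D
  rw [Submodule.ne_bot_iff]
  refine ⟨G, ?_, hG0⟩
  rintro q ⟨f', hf', p, hp, hpD, rfl⟩
  obtain ⟨c, hc, rfl⟩ := hΓ.exists_eq_C_mul hf'
  rw [curvatureForm_C_mul] at hpD
  rw [curvatureCentre_C_mul hc]
  have hD0 : eval p D ≠ 0 := by
    rw [hDe]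
    exact right_ne_zero_of_mul hpD
  have hp0 : eval p f = 0 := by
    have := hΓ.1 ▸ hp
    exact this
  have := hG p hp0 hD0
  rw [MvPolynomial.aeval_eq_eval]
  have hU : ∀ i, curvatureCentre f p i = eval p (U i) / eval p D := by
    intro i
    rw [eq_div_iff hD0]
    simp only [curvatureCentre, U, ← hDe, map_add, map_mul, map_pow, eval_X]
    field_simp
  have hpe : curvatureCentre f p = ![eval p (U 0) / eval p D, eval p (U 1) / eval p D] := by
    ext i
    fin_cases i
    · exact hU 0
    · exact hU 1
  rw [hpe]
  exact this

/-! ### Smoothed line arrangements and their ideals -/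

open Polynomial.Bivariate in
/-- A monic polynomial in `Y` of degree `d` with `d` distinct real roots for infinitely many values
of `X` is the equation of a curve. -/
theorem isEquationOf_of_monic {g : Polynomial (Polynomial ℝ)} (hg : g.Monic) {A : Set ℝ}
    (hA : A.Infinite) (hroots : ∀ x ∈ A, ∃ s : Finset ℝ, g.natDegree ≤ s.card ∧
      ∀ y ∈ s, g.evalEval x y = 0) :
    IsEquationOf (equivMvPolynomial ℝ g) {p | eval p (equivMvPolynomial ℝ g) = 0} := by
  refine ⟨rfl, le_antisymm ?_ ?_⟩
  · intro h hh
    rw [Ideal.mem_span_singleton]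
    set h' := (equivMvPolynomial ℝ).symm h with hh'
    have hvan : ∀ x y, g.evalEval x y = 0 → (h' %ₘ g).evalEval x y = 0 := by
      intro x y hxy
      have h1 : h'.evalEval x y = 0 := by
        have := hh ![x, y] (by
          change eval _ _ = 0
          rw [eval_equivMvPolynomial]
          simpa using hxy)
        rw [MvPolynomial.aeval_eq_eval] at this
        have h2 := eval_equivMvPolynomial h' ![x, y]
        rw [hh', AlgEquiv.apply_symm_apply] at h2
        simpa [this] using h2.symm
      have h3 := congrArg (Polynomial.evalEval x y) (Polynomial.modByMonic_add_div h' g)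
      rwa [Polynomial.evalEval_add, Polynomial.evalEval_mul, hxy, zero_mul, add_zero, h1] at h3
    -- Over each `x ∈ A` the remainder has smaller `Y`-degree than `g` but at least `g.natDegree`
    -- roots; its coefficients thus vanish at infinitely many `x`.
    have hr : h' %ₘ g = 0 := by
      rcases eq_or_ne g 1 with rfl | hg1
      · simp
      have hlt := Polynomial.natDegree_modByMonic_lt h' hg hg1
      have hz : ∀ x ∈ A, (h' %ₘ g).map (Polynomial.evalRingHom x) = 0 := by
        intro x hx
        obtain ⟨s, hs, hsz⟩ := hroots x hx
        refine Polynomial.eq_zero_of_natDegree_lt_card_of_eval_eq_zero' _ s (fun y hy => ?_)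
          ((Polynomial.natDegree_map_le).trans_lt (hlt.trans_le hs))
        rw [Polynomial.map_evalRingHom_eval]
        exact hvan x y (hsz y hy)
      ext1 j
      refine Polynomial.eq_zero_of_infinite_isRoot _ (hA.mono fun x hx => ?_)
      have := congrArg (fun q => Polynomial.coeff q j) (hz x hx)
      simpa using this
    rw [Polynomial.modByMonic_eq_zero_iff_dvd hg] at hr
    have := map_dvd (equivMvPolynomial ℝ) hr
    rwa [hh', AlgEquiv.apply_symm_apply] at this
  · rw [Ideal.span_singleton_le_iff_mem]
    intro p hp
    exact hp

/-- An equation of the tangent line of slope `k` to the parabola `4 y = x ^ 2`. -/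
noncomputable def tangentLine (k : ℝ) : MvPolynomial (Fin 2) ℝ := X 1 - C k * X 0 + C (k ^ 2)

/-- A perturbation of the union of `d` lines in general position. -/
noncomputable def perturbedLines (d : ℕ) (ε : ℝ) : MvPolynomial (Fin 2) ℝ :=
  ∏ k ∈ Finset.Icc 1 d, tangentLine k - C ε

theorem eval_tangentLine (k : ℝ) (p : Fin 2 → ℝ) :
    eval p (tangentLine k) = p 1 - k * p 0 + k ^ 2 := by
  simp [tangentLine]

theorem totalDegree_tangentLine_le (k : ℝ) : (tangentLine k).totalDegree ≤ 1 := by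
  refine (totalDegree_add _ _).trans (max_le ((totalDegree_sub _ _).trans (max_le ?_ ?_)) ?_)
  · simp
  · refine (totalDegree_mul _ _).trans ?_
    simp
  · exact (totalDegree_C _).trans_le zero_le_one

theorem exists_monic_perturbedLines (d : ℕ) (hd : 1 ≤ d) (ε : ℝ) :
    ∃ g : Polynomial (Polynomial ℝ), g.Monic ∧ g.natDegree = d ∧
      Polynomial.Bivariate.equivMvPolynomial ℝ g = perturbedLines d ε := by
  let l : ℕ → Polynomial (Polynomial ℝ) := fun k =>
    Polynomial.X - Polynomial.C (Polynomial.C (k : ℝ) * Polynomial.X - Polynomial.C ((k : ℝ) ^ 2))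
  have hm : ∀ k ∈ Finset.Icc 1 d, (l k).Monic := fun k _ => Polynomial.monic_X_sub_C _
  have hP : (∏ k ∈ Finset.Icc 1 d, l k).Monic := Polynomial.monic_prod_of_monic _ _ hm
  have hdeg : (∏ k ∈ Finset.Icc 1 d, l k).natDegree = d := by
    rw [Polynomial.natDegree_prod_of_monic _ _ hm]
    simp only [l, Polynomial.natDegree_X_sub_C]
    simp
  refine ⟨∏ k ∈ Finset.Icc 1 d, l k - Polynomial.C (Polynomial.C ε), ?_, ?_, ?_⟩
  · apply hP.sub_of_left
    refine Polynomial.degree_C_le.trans_lt ?_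
    rw [Polynomial.degree_eq_natDegree hP.ne_zero, hdeg]
    exact_mod_cast hd
  · rw [Polynomial.natDegree_sub_C, hdeg]
  · rw [perturbedLines, map_sub, map_prod, Polynomial.Bivariate.equivMvPolynomial_C_C]
    congr 1
    refine Finset.prod_congr rfl fun k _ => ?_
    simp only [l, map_sub, map_mul, map_pow, Polynomial.Bivariate.equivMvPolynomial_X,
      Polynomial.Bivariate.equivMvPolynomial_C_C, Polynomial.Bivariate.equivMvPolynomial_C_X,
      tangentLine]
    ring

theorem totalDegree_perturbedLines (d : ℕ) (ε : ℝ) :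
    (perturbedLines d ε).totalDegree = d := by
  apply le_antisymm
  · refine (totalDegree_sub_C_le _ _).trans ((totalDegree_finsetProd _ _).trans ?_)
    refine (Finset.sum_le_card_nsmul _ _ 1 fun k _ => totalDegree_tangentLine_le _).trans ?_
    simp
  -- For the lower bound, restrict to `x = 0`, where each line becomes the monic linear polynomial
  -- `Y + k²`.
  · have h := MvPolynomial.aeval_natDegree_le (m := (perturbedLines d ε).totalDegree)
      (perturbedLines d ε) le_rfl ![(0 : Polynomial ℝ), Polynomial.X] (n := 1) (by
        intro i
        fin_cases i <;> simp)
    rw [mul_one] at h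
    refine le_trans (le_of_eq ?_) h
    have hk : ∀ k : ℝ, aeval ![(0 : Polynomial ℝ), Polynomial.X] (tangentLine k) =
        Polynomial.X + Polynomial.C (k ^ 2) := by
      intro k
      simp [tangentLine, Polynomial.algebraMap_eq]
    rw [perturbedLines, map_sub, map_prod, aeval_C, Polynomial.algebraMap_eq,
      Polynomial.natDegree_sub_C]
    simp_rw [hk]
    rw [Polynomial.natDegree_prod_of_monic _ _ fun k _ => Polynomial.monic_X_add_C _]
    simp only [Polynomial.natDegree_X_add_C]
    simp

/-- The factors other than `y - a k` keep their signs on `[a k - 1, a k + 1]` and have absolute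
value at least `1` there. The product therefore has opposite signs and size at least `1 > ε` at the
two ends, and the intermediate value theorem applies. -/
theorem exists_prod_sub_eq {ι : Type*} [DecidableEq ι] (s : Finset ι) (a : ι → ℝ) {ε : ℝ}
    (hε : 0 < ε) (hε1 : ε < 1) {k : ι} (hk : k ∈ s)
    (ha : ∀ m ∈ s, m ≠ k → 3 ≤ |a k - a m|) :
    ∃ y, |y - a k| ≤ 1 ∧ ∏ m ∈ s, (y - a m) = ε := by
  set R : ℝ → ℝ := fun y => ∏ m ∈ s.erase k, (y - a m) with hR
  have hP : ∀ y, ∏ m ∈ s, (y - a m) = (y - a k) * R y := fun y =>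
    (Finset.mul_prod_erase s _ hk).symm
  have hgap : ∀ m ∈ s.erase k, 3 ≤ |a k - a m| := fun m hm =>
    ha m (Finset.mem_of_mem_erase hm) (Finset.ne_of_mem_erase hm)
  have hpos : 0 < R (a k - 1) * R (a k + 1) := by
    simp only [hR]
    rw [← Finset.prod_mul_distrib]
    refine Finset.prod_pos fun m hm => ?_
    rcases le_abs.1 (hgap m hm) with h | h <;> nlinarith
  have habs : ∀ y, |y - a k| ≤ 1 → 1 ≤ |R y| := by
    intro y hy
    simp only [hR]
    rw [Finset.abs_prod]
    refine Finset.prod_induction _ (fun t => (1 : ℝ) ≤ t) (fun _ _ => one_le_mul_of_one_le_of_one_le)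
      le_rfl fun m hm => ?_
    have := abs_le.1 hy
    rcases le_abs.1 (hgap m hm) with h | h
    · exact le_abs.2 (Or.inl (by linarith))
    · exact le_abs.2 (Or.inr (by linarith))
  have h1 := habs (a k - 1) (by norm_num)
  have h2 := habs (a k + 1) (by norm_num)
  have hcont : Continuous fun y => ∏ m ∈ s, (y - a m) :=
    continuous_finsetProd _ fun m _ => continuous_id.sub continuous_const
  have hmem : ε ∈ Set.uIcc (∏ m ∈ s, (a k - 1 - a m)) (∏ m ∈ s, (a k + 1 - a m)) := by
    rw [hP, hP, Set.mem_uIcc]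
    rcases le_abs.1 h1 with h | h <;> rcases le_abs.1 h2 with h' | h'
    · left; constructor <;> linarith
    · nlinarith
    · nlinarith
    · right; constructor <;> linarith
  obtain ⟨y, hy, hyε⟩ := intermediate_value_uIcc hcont.continuousOn hmem
  refine ⟨y, ?_, hyε⟩
  rw [Set.uIcc_of_le (by linarith)] at hy
  rw [abs_le]
  constructor <;> linarith [hy.1, hy.2]

theorem isEquationOf_perturbedLines (d : ℕ) (hd : 1 ≤ d) {ε : ℝ} (hε : 0 < ε) (hε1 : ε < 1) :
    IsEquationOf (perturbedLines d ε) {p | eval p (perturbedLines d ε) = 0} := by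
  obtain ⟨g, hg, hgd, hge⟩ := exists_monic_perturbedLines d hd ε
  rw [← hge]
  refine isEquationOf_of_monic hg (Set.Iic_infinite (0 : ℝ)) fun x hx => ?_
  set a : ℕ → ℝ := fun k => k * x - (k : ℝ) ^ 2 with ha
  -- The difference is `(k - m)(k + m - x)`, with `k - m ≥ 1`, `k + m ≥ 3` and `x ≤ 0`.
  have hgap' : ∀ m k : ℕ, 1 ≤ m → m < k → 3 ≤ a m - a k := by
    intro m k hm hmk
    have h1 : (1 : ℝ) ≤ m := by exact_mod_cast hm
    have h2 : (m : ℝ) + 1 ≤ k := by exact_mod_cast hmk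
    have hx' : x ≤ 0 := hx
    simp only [ha]
    nlinarith
  have hgap : ∀ k ∈ Finset.Icc 1 d, ∀ m ∈ Finset.Icc 1 d, m ≠ k → 3 ≤ |a k - a m| := by
    intro k hk m hm hmk
    rcases lt_or_gt_of_ne hmk with h | h
    · exact le_abs.2 (Or.inr (by linarith [hgap' m k (Finset.mem_Icc.1 hm).1 h]))
    · exact le_abs.2 (Or.inl (hgap' k m (Finset.mem_Icc.1 hk).1 h))
  choose! y hy hyε using fun k (hk : k ∈ Finset.Icc 1 d) =>
    exists_prod_sub_eq (Finset.Icc 1 d) a hε hε1 hk (hgap k hk)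
  refine ⟨(Finset.Icc 1 d).image y, ?_, ?_⟩
  · rw [Finset.card_image_of_injOn, hgd, Nat.card_Icc, Nat.add_sub_cancel]
    intro k hk m hm hkm
    by_contra hne
    have h3 := hgap k hk m hm (Ne.symm hne)
    have h1 := abs_le.1 (hy k hk)
    have h2 := abs_le.1 (hy m hm)
    rw [hkm] at h1
    rcases le_abs.1 h3 with h | h <;> linarith
  · intro z hz
    obtain ⟨k, hk, rfl⟩ := Finset.mem_image.1 hz
    have h := eval_equivMvPolynomial g ![x, y k]
    rw [hge, perturbedLines, map_sub, map_prod, eval_C] at h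
    simp only [eval_tangentLine, Matrix.cons_val_zero, Matrix.cons_val_one] at h
    rw [← h, ← hyε k hk, sub_eq_zero]
    refine Finset.prod_congr rfl fun m _ => ?_
    simp only [ha]
    ring

theorem contDiff_eval {E : Type*} [NormedAddCommGroup E] [NormedSpace ℝ E] {ι : Type*}
    (P : MvPolynomial ι ℝ) {φ : E → ι → ℝ} {n : WithTop ℕ∞}
    (hφ : ∀ i, ContDiff ℝ n fun z => φ z i) : ContDiff ℝ n fun z => eval (φ z) P := by
  induction P using MvPolynomial.induction_on with
  | C a => simpa using contDiff_const
  | add p q hp hq => simpa using hp.add hq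
  | mul_X p i hp => simpa using hp.mul (hφ i)

/-! ### Differentiation in the affine coordinates `(l_i, l_j)` -/

section Oblique

variable (i j : ℝ)

/-- The derivation of the plane with values `1` and `0` on the equations of the tangent lines of
slopes `i` and `j`. -/
noncomputable def obliqueDeriv : Derivation ℝ (MvPolynomial (Fin 2) ℝ) (MvPolynomial (Fin 2) ℝ) :=
  (C (j - i)⁻¹ : MvPolynomial (Fin 2) ℝ) • (pderiv 0 + (C j : MvPolynomial (Fin 2) ℝ) • pderiv 1)

theorem obliqueDeriv_apply (f : MvPolynomial (Fin 2) ℝ) :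
    obliqueDeriv i j f = C (j - i)⁻¹ * (pderiv 0 f + C j * pderiv 1 f) := rfl

variable {i j}

theorem obliqueDeriv_tangentLine_left (hij : i ≠ j) : obliqueDeriv i j (tangentLine i) = 1 := by
  have h : j - i ≠ 0 := sub_ne_zero.2 hij.symm
  rw [obliqueDeriv_apply]
  simp only [tangentLine, map_add, map_sub, pderiv_C_mul, pderiv_X, pderiv_C, Pi.single_apply]
  simp only [Fin.isValue, zero_ne_one, one_ne_zero, if_true, if_false]
  rw [show (0 : MvPolynomial (Fin 2) ℝ) - C i * 1 + 0 + C j * (1 - C i * 0 + 0) = C (j - i) by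
    rw [map_sub]; ring, ← map_mul, inv_mul_cancel₀ h, map_one]

theorem obliqueDeriv_tangentLine_right : obliqueDeriv i j (tangentLine j) = 0 := by
  rw [obliqueDeriv_apply]
  simp only [tangentLine, map_add, map_sub, pderiv_C_mul, pderiv_X, pderiv_C, Pi.single_apply]
  simp

theorem pderiv_comm (f : MvPolynomial (Fin 2) ℝ) :
    pderiv 1 (pderiv 0 f) = pderiv 0 (pderiv 1 f) := by
  have : ⁅pderiv (R := ℝ) (1 : Fin 2), pderiv (R := ℝ) (0 : Fin 2)⁆ = 0 := by
    apply MvPolynomial.derivation_ext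
    intro k
    fin_cases k <;> simp [Derivation.commutator_apply, pderiv_X]
  have h := DFunLike.congr_fun this f
  rw [Derivation.commutator_apply] at h
  exact sub_eq_zero.1 h

theorem pderiv_zero_eq_obliqueDeriv (hij : i ≠ j) (f : MvPolynomial (Fin 2) ℝ) :
    pderiv 0 f = -C i * obliqueDeriv i j f - C j * obliqueDeriv j i f := by
  have h : j - i ≠ 0 := sub_ne_zero.2 hij.symm
  have h1 : (C (j - i)⁻¹ : MvPolynomial (Fin 2) ℝ) * (C j - C i) = 1 := by
    rw [← map_sub, ← map_mul, inv_mul_cancel₀ h, map_one]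
  have h2 : (C (i - j)⁻¹ : MvPolynomial (Fin 2) ℝ) = - C (j - i)⁻¹ := by
    rw [← map_neg, ← inv_neg, neg_sub]
  rw [obliqueDeriv_apply, obliqueDeriv_apply, h2]
  linear_combination -pderiv 0 f * h1

theorem pderiv_one_eq_obliqueDeriv (hij : i ≠ j) (f : MvPolynomial (Fin 2) ℝ) :
    pderiv 1 f = obliqueDeriv i j f + obliqueDeriv j i f := by
  have h : j - i ≠ 0 := sub_ne_zero.2 hij.symm
  have h1 : (C (j - i)⁻¹ : MvPolynomial (Fin 2) ℝ) * (C j - C i) = 1 := by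
    rw [← map_sub, ← map_mul, inv_mul_cancel₀ h, map_one]
  have h2 : (C (i - j)⁻¹ : MvPolynomial (Fin 2) ℝ) = - C (j - i)⁻¹ := by
    rw [← map_neg, ← inv_neg, neg_sub]
  rw [obliqueDeriv_apply, obliqueDeriv_apply, h2]
  linear_combination -pderiv 1 f * h1

theorem obliqueDeriv_C (a : ℝ) : obliqueDeriv i j (C a) = 0 := by
  simp

theorem obliqueDeriv_comm (f : MvPolynomial (Fin 2) ℝ) :
    obliqueDeriv j i (obliqueDeriv i j f) = obliqueDeriv i j (obliqueDeriv j i f) := by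
  simp only [obliqueDeriv_apply, pderiv_C_mul, map_add, pderiv_comm]
  ring

/-- The curvature form is minus the Hessian evaluated on the rotated gradient, so a linear change of
coordinates multiplies it by the squared determinant, here `(j - i) ^ 2`. -/
theorem curvatureForm_eq_obliqueDeriv (hij : i ≠ j) (f : MvPolynomial (Fin 2) ℝ)
    (p : Fin 2 → ℝ) :
    curvatureForm f p = -(j - i) ^ 2 *
      (eval p (obliqueDeriv i j (obliqueDeriv i j f)) * eval p (obliqueDeriv j i f) ^ 2
        - 2 * eval p (obliqueDeriv i j (obliqueDeriv j i f)) * eval p (obliqueDeriv i j f)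
          * eval p (obliqueDeriv j i f)
        + eval p (obliqueDeriv j i (obliqueDeriv j i f)) * eval p (obliqueDeriv i j f) ^ 2) := by
  unfold curvatureForm
  rw [pderiv_zero_eq_obliqueDeriv hij (pderiv 1 f), pderiv_zero_eq_obliqueDeriv hij (pderiv 0 f),
    pderiv_one_eq_obliqueDeriv hij (pderiv 1 f), pderiv_zero_eq_obliqueDeriv hij f,
    pderiv_one_eq_obliqueDeriv hij f]
  have hC : ∀ a b : ℝ, ∀ c q, obliqueDeriv a b (C c * q) = C c * obliqueDeriv a b q := by
    intro a b c q
    rw [Derivation.leibniz, obliqueDeriv_C, smul_zero, add_zero, smul_eq_mul]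
  simp only [map_add, map_sub, neg_mul, map_neg, hC, obliqueDeriv_comm, map_mul, eval_C]
  ring

end Oblique

/-! ### The evolute near a smoothed node -/

section Node

variable (i j : ℝ) (Q : MvPolynomial (Fin 2) ℝ)

/-- The point at which the tangent lines of slopes `i` and `j` take the values `h ^ 2 * σ` and
`h * τ`, where `z = (σ, τ, h)`. -/
noncomputable def nodePoint (z : ℝ × ℝ × ℝ) : Fin 2 → ℝ :=
  ![(z.2.2 ^ 2 * z.1 - z.2.2 * z.2.1) / (j - i) + i + j,
    z.2.2 ^ 2 * z.1 + i * ((z.2.2 ^ 2 * z.1 - z.2.2 * z.2.1) / (j - i) + i + j) - i ^ 2]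

/-- The derivative of `l_i * l_j * Q` along the `j`-th line, divided by `h`. -/
noncomputable def scaledDerivLeft (z : ℝ × ℝ × ℝ) : ℝ :=
  z.2.1 * eval (nodePoint i j z) Q +
    z.2.2 ^ 2 * z.1 * z.2.1 * eval (nodePoint i j z) (obliqueDeriv i j Q)

/-- The derivative of `l_i * l_j * Q` along the `i`-th line, divided by `h ^ 2`. -/
noncomputable def scaledDerivRight (z : ℝ × ℝ × ℝ) : ℝ :=
  z.1 * eval (nodePoint i j z) Q +
    z.2.2 * z.1 * z.2.1 * eval (nodePoint i j z) (obliqueDeriv j i Q)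

/-- The curvature form of `l_i * l_j * Q`, divided by `h ^ 3`. -/
noncomputable def scaledForm (z : ℝ × ℝ × ℝ) : ℝ :=
  -(j - i) ^ 2 *
    (z.2.2 ^ 2 * (2 * z.2.1 * eval (nodePoint i j z) (obliqueDeriv i j Q) +
        z.2.2 ^ 2 * z.1 * z.2.1 * eval (nodePoint i j z) (obliqueDeriv i j (obliqueDeriv i j Q))) *
        scaledDerivRight i j Q z ^ 2
      - 2 * (eval (nodePoint i j z) Q +
          z.2.2 ^ 2 * z.1 * eval (nodePoint i j z) (obliqueDeriv i j Q) +
          z.2.2 * z.2.1 * eval (nodePoint i j z) (obliqueDeriv j i Q) +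
          z.2.2 ^ 3 * z.1 * z.2.1 *
            eval (nodePoint i j z) (obliqueDeriv i j (obliqueDeriv j i Q))) *
        scaledDerivLeft i j Q z * scaledDerivRight i j Q z
      + z.2.2 * (2 * z.1 * eval (nodePoint i j z) (obliqueDeriv j i Q) +
        z.2.2 * z.1 * z.2.1 * eval (nodePoint i j z) (obliqueDeriv j i (obliqueDeriv j i Q))) *
        scaledDerivLeft i j Q z ^ 2)

/-- The gradient of `l_i * l_j * Q`, divided by `h`. -/
noncomputable def scaledGradient (z : ℝ × ℝ × ℝ) : Fin 2 → ℝ :=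
  ![-i * scaledDerivLeft i j Q z - j * z.2.2 * scaledDerivRight i j Q z,
    scaledDerivLeft i j Q z + z.2.2 * scaledDerivRight i j Q z]

/-- The centre of curvature at `nodePoint i j z`, in a form that makes sense for `h = 0`. -/
noncomputable def scaledCentre (z : ℝ × ℝ × ℝ) (k : Fin 2) : ℝ :=
  nodePoint i j z k + scaledGradient i j Q z k *
    (scaledGradient i j Q z 0 ^ 2 + scaledGradient i j Q z 1 ^ 2) / scaledForm i j Q z

variable {i j}

theorem eval_nodePoint_left (z : ℝ × ℝ × ℝ) :
    eval (nodePoint i j z) (tangentLine i) = z.2.2 ^ 2 * z.1 := by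
  rw [eval_tangentLine]
  simp only [nodePoint, Matrix.cons_val_zero, Matrix.cons_val_one]
  ring

theorem eval_nodePoint_right (hij : i ≠ j) (z : ℝ × ℝ × ℝ) :
    eval (nodePoint i j z) (tangentLine j) = z.2.2 * z.2.1 := by
  have h : j - i ≠ 0 := sub_ne_zero.2 hij.symm
  rw [eval_tangentLine]
  simp only [nodePoint, Matrix.cons_val_zero, Matrix.cons_val_one]
  field_simp
  ring

theorem nodePoint_zero (σ τ : ℝ) : nodePoint i j (σ, τ, 0) = ![i + j, i * j] := by
  simp [nodePoint]
  ring

variable {Q} {ε : ℝ} {z : ℝ × ℝ × ℝ}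

theorem obliqueDeriv_mul_sub (hij : i ≠ j) :
    obliqueDeriv i j (tangentLine i * tangentLine j * Q - C ε) =
      tangentLine j * Q + tangentLine i * tangentLine j * obliqueDeriv i j Q := by
  simp only [map_sub, Derivation.leibniz, obliqueDeriv_C, obliqueDeriv_tangentLine_left hij,
    obliqueDeriv_tangentLine_right, smul_eq_mul]
  ring

theorem obliqueDeriv_mul_sub' (hij : i ≠ j) :
    obliqueDeriv j i (tangentLine i * tangentLine j * Q - C ε) =
      tangentLine i * Q + tangentLine i * tangentLine j * obliqueDeriv j i Q := by
  simp only [map_sub, Derivation.leibniz, obliqueDeriv_C, obliqueDeriv_tangentLine_left hij.symm,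
    obliqueDeriv_tangentLine_right, smul_eq_mul]
  ring

/-- The first derivatives in `l_i` and `l_j` have orders `h` and `h²`. The mixed second derivative
has order one, so its term has order `h³`; the terms with pure second derivatives have orders `h⁵`
and `h⁴`. -/
theorem curvatureForm_nodePoint (hij : i ≠ j) :
    curvatureForm (tangentLine i * tangentLine j * Q - C ε) (nodePoint i j z) =
      z.2.2 ^ 3 * scaledForm i j Q z := by
  rw [curvatureForm_eq_obliqueDeriv hij, obliqueDeriv_mul_sub hij, obliqueDeriv_mul_sub' hij]
  simp only [map_add, Derivation.leibniz, obliqueDeriv_tangentLine_left hij,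
    obliqueDeriv_tangentLine_left hij.symm, obliqueDeriv_tangentLine_right, smul_eq_mul, map_mul,
    map_zero, map_one, eval_nodePoint_left, eval_nodePoint_right hij, scaledForm, scaledDerivLeft,
    scaledDerivRight]
  ring

theorem eval_pderiv_nodePoint (hij : i ≠ j) (k : Fin 2) :
    eval (nodePoint i j z) (pderiv k (tangentLine i * tangentLine j * Q - C ε)) =
      z.2.2 * scaledGradient i j Q z k := by
  fin_cases k
  · change eval _ (pderiv 0 _) = z.2.2 * scaledGradient i j Q z 0
    rw [pderiv_zero_eq_obliqueDeriv hij, obliqueDeriv_mul_sub hij, obliqueDeriv_mul_sub' hij]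
    simp only [map_add, map_sub, map_neg, map_mul, eval_C, eval_nodePoint_left,
      eval_nodePoint_right hij, scaledGradient, scaledDerivLeft, scaledDerivRight,
      Matrix.cons_val_zero]
    ring
  · change eval _ (pderiv 1 _) = z.2.2 * scaledGradient i j Q z 1
    rw [pderiv_one_eq_obliqueDeriv hij, obliqueDeriv_mul_sub hij, obliqueDeriv_mul_sub' hij]
    simp only [map_add, map_mul, eval_nodePoint_left,
      eval_nodePoint_right hij, scaledGradient, scaledDerivLeft, scaledDerivRight,
      Matrix.cons_val_one, Matrix.cons_val_fin_one]
    ring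

/-- The cubic gradient factor and the curvature form both carry `h ^ 3`, which cancels; the weights
`2` and `1` are chosen for this balance. -/
theorem curvatureCentre_nodePoint (hij : i ≠ j) (hz : z.2.2 ≠ 0) (k : Fin 2) :
    curvatureCentre (tangentLine i * tangentLine j * Q - C ε) (nodePoint i j z) k =
      scaledCentre i j Q z k := by
  simp only [curvatureCentre, curvatureForm_nodePoint hij, eval_pderiv_nodePoint hij, scaledCentre]
  congr 1
  rw [← mul_div_mul_left _ (scaledForm i j Q z) (pow_ne_zero 3 hz)]
  ring

theorem scaledForm_zero (σ τ : ℝ) :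
    scaledForm i j Q (σ, τ, 0) = 2 * (j - i) ^ 2 * σ * τ * eval ![i + j, i * j] Q ^ 3 := by
  simp only [scaledForm, scaledDerivLeft, scaledDerivRight, nodePoint_zero]
  ring

/-- In the limit the gradient is proportional to `(-i, 1)`, so the centre lies on the normal to
`l_i` at the node. -/
theorem scaledCentre_zero (hij : i ≠ j) (hQ : eval ![i + j, i * j] Q ≠ 0) {σ τ : ℝ}
    (hσ : σ ≠ 0) (hτ : τ ≠ 0) (k : Fin 2) :
    scaledCentre i j Q (σ, τ, 0) k =
      ![i + j, i * j] k + ![-i, 1] k * ((i ^ 2 + 1) / (2 * (j - i) ^ 2) * (τ ^ 2 / σ)) := by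
  have h : j - i ≠ 0 := sub_ne_zero.2 hij.symm
  rw [scaledCentre, scaledForm_zero, nodePoint_zero]
  congr 1
  fin_cases k <;>
  simp only [scaledGradient, scaledDerivLeft, nodePoint_zero, Fin.zero_eta, Fin.mk_one,
    Matrix.cons_val_zero, Matrix.cons_val_one] <;>
  field_simp <;> ring

theorem contDiff_nodePoint (k : Fin 2) : ContDiff ℝ 1 fun z => nodePoint i j z k := by
  fin_cases k <;>
  simp only [nodePoint, Fin.zero_eta, Fin.mk_one, Matrix.cons_val_zero, Matrix.cons_val_one] <;>
  fun_prop

theorem contDiff_eval_nodePoint (P : MvPolynomial (Fin 2) ℝ) :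
    ContDiff ℝ 1 fun z => eval (nodePoint i j z) P :=
  contDiff_eval P contDiff_nodePoint

theorem contDiff_scaledDerivLeft : ContDiff ℝ 1 (scaledDerivLeft i j Q) := by
  unfold scaledDerivLeft
  have := contDiff_eval_nodePoint (i := i) (j := j) Q
  have := contDiff_eval_nodePoint (i := i) (j := j) (obliqueDeriv i j Q)
  fun_prop

theorem contDiff_scaledDerivRight : ContDiff ℝ 1 (scaledDerivRight i j Q) := by
  unfold scaledDerivRight
  have := contDiff_eval_nodePoint (i := i) (j := j) Q
  have := contDiff_eval_nodePoint (i := i) (j := j) (obliqueDeriv j i Q)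
  fun_prop

theorem contDiff_scaledForm : ContDiff ℝ 1 (scaledForm i j Q) := by
  have key : ∀ a b q qs qt qss qst qtt : ℝ × ℝ × ℝ → ℝ, ContDiff ℝ 1 a → ContDiff ℝ 1 b →
      ContDiff ℝ 1 q → ContDiff ℝ 1 qs → ContDiff ℝ 1 qt → ContDiff ℝ 1 qss → ContDiff ℝ 1 qst →
      ContDiff ℝ 1 qtt → ContDiff ℝ 1 fun z : ℝ × ℝ × ℝ => -(j - i) ^ 2 *
        (z.2.2 ^ 2 * (2 * z.2.1 * qs z + z.2.2 ^ 2 * z.1 * z.2.1 * qss z) * b z ^ 2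
          - 2 * (q z + z.2.2 ^ 2 * z.1 * qs z + z.2.2 * z.2.1 * qt z +
              z.2.2 ^ 3 * z.1 * z.2.1 * qst z) * a z * b z
          + z.2.2 * (2 * z.1 * qt z + z.2.2 * z.1 * z.2.1 * qtt z) * a z ^ 2) := by
    intros
    fun_prop
  exact key _ _ _ _ _ _ _ _ contDiff_scaledDerivLeft contDiff_scaledDerivRight
    (contDiff_eval_nodePoint _) (contDiff_eval_nodePoint _) (contDiff_eval_nodePoint _)
    (contDiff_eval_nodePoint _) (contDiff_eval_nodePoint _) (contDiff_eval_nodePoint _)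

theorem contDiff_scaledGradient (k : Fin 2) : ContDiff ℝ 1 fun z => scaledGradient i j Q z k := by
  have := contDiff_scaledDerivLeft (i := i) (j := j) (Q := Q)
  have := contDiff_scaledDerivRight (i := i) (j := j) (Q := Q)
  fin_cases k <;>
  simp only [scaledGradient, Fin.zero_eta, Fin.mk_one, Matrix.cons_val_zero, Matrix.cons_val_one] <;>
  fun_prop

theorem contDiffAt_scaledCentre (hz : scaledForm i j Q z ≠ 0) (k : Fin 2) :
    ContDiffAt ℝ 1 (fun z => scaledCentre i j Q z k) z := by
  unfold scaledCentre
  have h (k) := (contDiff_scaledGradient (i := i) (j := j) (Q := Q) k).contDiffAt (x := z)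
  exact (contDiff_nodePoint k).contDiffAt.add
    (((h k).mul (((h 0).pow 2).add ((h 1).pow 2))).div contDiff_scaledForm.contDiffAt hz)

/-- The map sending `(σ, τ, h)` to the level of `l_i * l_j * Q` divided by `h ^ 3`, the abscissa of
the centre of curvature, and `h`. -/
noncomputable def nodeMap (i j : ℝ) (Q : MvPolynomial (Fin 2) ℝ) (z : ℝ × ℝ × ℝ) : ℝ × ℝ × ℝ :=
  (z.1 * z.2.1 * eval (nodePoint i j z) Q, scaledCentre i j Q z 0, z.2.2)

/-- The derivative is onto: `h` is a component of the map, and at `h = 0` the remaining block in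
`(σ, τ)` is explicit, with determinant `-3 i m τ² q / σ`. This is where `i ≠ 0` enters: the normal
to `l_i` must not be vertical. -/
theorem map_nodeMap_nhds (hij : i ≠ j) (hi : i ≠ 0) (hQ : eval ![i + j, i * j] Q ≠ 0) {σ τ : ℝ}
    (hσ : σ ≠ 0) (hτ : τ ≠ 0) :
    Filter.map (nodeMap i j Q) (𝓝 (σ, τ, 0)) = 𝓝 (nodeMap i j Q (σ, τ, 0)) := by
  have h : j - i ≠ 0 := sub_ne_zero.2 hij.symm
  have hform : scaledForm i j Q (σ, τ, 0) ≠ 0 := by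
    rw [scaledForm_zero]
    positivity
  have hcd : ContDiffAt ℝ 1 (nodeMap i j Q) (σ, τ, 0) := by
    have := (contDiff_eval_nodePoint (i := i) (j := j) Q).contDiffAt (x := (σ, τ, 0))
    have := contDiffAt_scaledCentre hform 0
    unfold nodeMap
    fun_prop
  have hstrict := hcd.hasStrictFDerivAt one_ne_zero
  refine hstrict.map_nhds_eq_of_surj ?_
  set L := fderiv ℝ (nodeMap i j Q) (σ, τ, 0) with hL
  have hF : HasFDerivAt (nodeMap i j Q) L (σ, τ, 0) := hstrict.hasFDerivAt
  set q := eval ![i + j, i * j] Q with hq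
  set m := (i ^ 2 + 1) / (2 * (j - i) ^ 2) with hm
  have hm0 : m ≠ 0 := by positivity
  have hzero : ∀ s t : ℝ, s ≠ 0 → t ≠ 0 →
      nodeMap i j Q (s, t, 0) = (s * t * q, i + j + -i * (m * (t ^ 2 / s)), 0) := by
    intro s t hs ht
    rw [nodeMap, scaledCentre_zero hij hQ hs ht, nodePoint_zero]
    rfl
  have h1 : L (1, 0, 0) = (τ * q, i * m * (τ ^ 2 / σ ^ 2), 0) := by
    have hc : HasDerivAt (fun s : ℝ => (s, τ, (0 : ℝ))) (1, 0, 0) σ :=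
      (hasDerivAt_id σ).prodMk (hasDerivAt_const σ (τ, (0 : ℝ)))
    have hd := hF.comp_hasDerivAt σ hc
    have he : HasDerivAt (fun s : ℝ => (s * τ * q, i + j + -i * (m * (τ ^ 2 / s)), (0 : ℝ)))
        (τ * q, i * m * (τ ^ 2 / σ ^ 2), 0) σ := by
      refine HasDerivAt.prodMk ?_ (HasDerivAt.prodMk ?_ (hasDerivAt_const _ _))
      · simpa using ((hasDerivAt_id σ).mul_const τ).mul_const q
      · have := ((((hasDerivAt_inv hσ).const_mul (τ ^ 2)).const_mul m).const_mul (-i)).const_add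
          (i + j)
        convert this using 1
        · simp only [div_eq_mul_inv]
        · ring
    refine hd.unique (he.congr_of_eventuallyEq ?_)
    filter_upwards [isOpen_ne.mem_nhds hσ] with s hs
    exact hzero s τ hs hτ
  have h2 : L (0, 1, 0) = (σ * q, -i * m * (2 * τ / σ), 0) := by
    have hc : HasDerivAt (fun t : ℝ => (σ, t, (0 : ℝ))) (0, 1, 0) τ :=
      (hasDerivAt_const τ σ).prodMk ((hasDerivAt_id τ).prodMk (hasDerivAt_const τ (0 : ℝ)))
    have hd := hF.comp_hasDerivAt τ hc
    have he : HasDerivAt (fun t : ℝ => (σ * t * q, i + j + -i * (m * (t ^ 2 / σ)), (0 : ℝ)))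
        (σ * q, -i * m * (2 * τ / σ), 0) τ := by
      refine HasDerivAt.prodMk ?_ (HasDerivAt.prodMk ?_ (hasDerivAt_const _ _))
      · simpa using ((hasDerivAt_id τ).const_mul σ).mul_const q
      · have := ((((hasDerivAt_pow 2 τ).div_const σ).const_mul m).const_mul (-i)).const_add
          (i + j)
        convert this using 1
        simp
        ring
    refine hd.unique (he.congr_of_eventuallyEq ?_)
    filter_upwards [isOpen_ne.mem_nhds hτ] with t ht
    exact hzero σ t hσ ht
  have h3 : (L (0, 0, 1)).2.2 = 1 := by
    have hsnd : HasFDerivAt (fun z : ℝ × ℝ × ℝ => z.2.2)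
        ((ContinuousLinearMap.snd ℝ ℝ ℝ).comp (ContinuousLinearMap.snd ℝ ℝ (ℝ × ℝ)))
        (σ, τ, 0) :=
      ((ContinuousLinearMap.snd ℝ ℝ ℝ).comp
        (ContinuousLinearMap.snd ℝ ℝ (ℝ × ℝ))).hasFDerivAt
    have hcomp := hF.snd.snd
    have := DFunLike.congr_fun (hcomp.unique hsnd) (0, 0, 1)
    simpa using this
  rw [LinearMap.range_eq_top]
  intro w
  -- Removing the `h`-direction leaves a two-by-two system, solved by Cramer's rule; the other
  -- components of `L (0, 0, 1)` are irrelevant.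
  set u := w - w.2.2 • L (0, 0, 1) with hu
  have hu2 : u.2.2 = 0 := by simp [hu, h3]
  have hdet : 3 * i * m * τ ^ 2 * q ≠ 0 := by positivity
  obtain ⟨a, b, hab1, hab2⟩ : ∃ a b : ℝ, a * (τ * q) + b * (σ * q) = u.1 ∧
      a * (i * m * (τ ^ 2 / σ ^ 2)) + b * (-i * m * (2 * τ / σ)) = u.2.1 := by
    refine ⟨(2 * i * m * τ * u.1 + σ ^ 2 * q * u.2.1) / (3 * i * m * τ ^ 2 * q),
      (i * m * τ ^ 2 * u.1 / σ - σ * τ * q * u.2.1) / (3 * i * m * τ ^ 2 * q), ?_, ?_⟩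
    · field_simp
      ring
    · field_simp
      ring
  refine ⟨a • (1, 0, 0) + b • (0, 1, 0) + w.2.2 • (0, 0, 1), ?_⟩
  change L _ = w
  rw [map_add, map_add, map_smul, map_smul, map_smul, h1, h2]
  have hw : w = u + w.2.2 • L (0, 0, 1) := by rw [hu, sub_add_cancel]
  conv_rhs => rw [hw]
  congr 1
  refine Prod.ext ?_ (Prod.ext ?_ ?_)
  · simpa using hab1
  · simpa using hab2
  · simp [hu2]

theorem exists_cube_eq (a : ℝ) : ∃ t : ℝ, t ^ 3 = a := by
  rcases le_total 0 a with ha | ha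
  · exact ⟨_, Real.rpow_inv_natCast_pow ha three_ne_zero⟩
  · refine ⟨-(-a) ^ (((3 : ℕ) : ℝ)⁻¹), ?_⟩
    rw [Odd.neg_pow (by decide), Real.rpow_inv_natCast_pow (neg_nonneg.2 ha) three_ne_zero, neg_neg]

/-- Near the normal at the node `(i + j, i * j)` to the line of slope `i`, the evolutes of small
smoothings of the node meet all vertical lines close to a given one. -/
theorem eventually_exists_curvatureCentre (hij : i ≠ j) (hi : i ≠ 0)
    (hQ : eval ![i + j, i * j] Q ≠ 0) {c₀ : ℝ} (hc₀ : c₀ ≠ i + j) {δ : ℝ} (hδ : 0 < δ) :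
    ∀ᶠ w : ℝ × ℝ in 𝓝 (c₀, 0), w.2 ≠ 0 → ∃ p,
      eval p (tangentLine i * tangentLine j * Q - C (w.2 ^ 3)) = 0 ∧
      curvatureForm (tangentLine i * tangentLine j * Q - C (w.2 ^ 3)) p ≠ 0 ∧
      curvatureCentre (tangentLine i * tangentLine j * Q - C (w.2 ^ 3)) p 0 = w.1 ∧
      |curvatureCentre (tangentLine i * tangentLine j * Q - C (w.2 ^ 3)) p 1 -
        (i * j + (i + j - c₀) / i)| < δ := by
  have h : j - i ≠ 0 := sub_ne_zero.2 hij.symm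
  set q := eval ![i + j, i * j] Q with hq
  set m := (i ^ 2 + 1) / (2 * (j - i) ^ 2) with hm
  have hm0 : m ≠ 0 := by positivity
  have hr : (i + j - c₀) / i ≠ 0 := div_ne_zero (sub_ne_zero.2 hc₀.symm) hi
  -- On the limiting level `σ τ q = 1` the displacement `m τ² / σ` equals `m q τ³`; a real cube root
  -- thus reaches every point of the normal, and `c₀ ≠ i + j` keeps `τ` nonzero.
  obtain ⟨τ, hτ3⟩ := exists_cube_eq ((i + j - c₀) / i / (m * q))
  have hτ : τ ≠ 0 := by
    rintro rfl
    rw [eq_comm, zero_pow three_ne_zero] at hτ3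
    exact div_ne_zero hr (mul_ne_zero hm0 hQ) hτ3
  set σ := (τ * q)⁻¹ with hσd
  have hσ : σ ≠ 0 := inv_ne_zero (mul_ne_zero hτ hQ)
  have hστ : m * (τ ^ 2 / σ) = (i + j - c₀) / i := by
    rw [eq_div_iff (mul_ne_zero hm0 hQ)] at hτ3
    rw [← hτ3, hσd]
    field_simp
  have hform : scaledForm i j Q (σ, τ, 0) ≠ 0 := by
    rw [scaledForm_zero]
    positivity
  have hval : nodeMap i j Q (σ, τ, 0) = (1, c₀, 0) := by
    rw [nodeMap, scaledCentre_zero hij hQ hσ hτ, nodePoint_zero, ← hm, hστ, ← hq]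
    refine Prod.ext ?_ (Prod.ext ?_ rfl)
    · simp only [hσd]
      field_simp
    · simp only [Matrix.cons_val_zero]
      field_simp
      ring
  have hmap := map_nodeMap_nhds hij hi hQ hσ hτ
  rw [hval] at hmap
  have hcen : scaledCentre i j Q (σ, τ, 0) 1 = i * j + (i + j - c₀) / i := by
    rw [scaledCentre_zero hij hQ hσ hτ, ← hm, hστ]
    simp
  have hU : ∀ᶠ z in 𝓝 (σ, τ, 0), scaledForm i j Q z ≠ 0 ∧
      |scaledCentre i j Q z 1 - (i * j + (i + j - c₀) / i)| < δ := by
    refine (contDiff_scaledForm.continuous.continuousAt.eventually_ne hform).and ?_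
    have := (contDiffAt_scaledCentre hform 1).continuousAt
    rw [ContinuousAt, hcen, Metric.tendsto_nhds] at this
    exact this δ hδ
  have himg := Filter.image_mem_map (m := nodeMap i j Q) hU
  rw [hmap] at himg
  have htend : Filter.Tendsto (fun w : ℝ × ℝ => ((1 : ℝ), w.1, w.2)) (𝓝 (c₀, 0))
      (𝓝 (1, c₀, 0)) := by
    have : Continuous (fun w : ℝ × ℝ => ((1 : ℝ), w.1, w.2)) := by fun_prop
    exact this.tendsto (c₀, 0)
  filter_upwards [htend himg] with w hw hw0
  obtain ⟨z, ⟨hz1, hz2⟩, hz⟩ := hw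
  have e1 := congrArg Prod.fst hz
  have e2 := congrArg (fun t : ℝ × ℝ × ℝ => t.2.1) hz
  have e3 := congrArg (fun t : ℝ × ℝ × ℝ => t.2.2) hz
  simp only [nodeMap] at e1 e2 e3
  have hz0 : z.2.2 ≠ 0 := by rwa [e3]
  refine ⟨nodePoint i j z, ?_, ?_, ?_, ?_⟩
  · simp only [map_sub, map_mul, eval_nodePoint_left, eval_nodePoint_right hij, eval_C]
    rw [← e3]
    linear_combination z.2.2 ^ 3 * e1
  · rw [curvatureForm_nodePoint hij]
    exact mul_ne_zero (pow_ne_zero 3 hz0) hz1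
  · rw [curvatureCentre_nodePoint hij hz0, e2]
  · rw [curvatureCentre_nodePoint hij hz0]
    exact hz2

end Node

/-! ### Counting intersections with a vertical line -/

theorem perturbedLines_eq {d i j : ℕ} (hi : i ∈ Finset.Icc 1 d) (hj : j ∈ Finset.Icc 1 d)
    (hij : i ≠ j) (ε : ℝ) :
    perturbedLines d ε = tangentLine i * tangentLine j *
      (∏ k ∈ ((Finset.Icc 1 d).erase i).erase j, tangentLine k) - C ε := by
  rw [mul_assoc, Finset.mul_prod_erase _ (fun k : ℕ => tangentLine k)
    (Finset.mem_erase.2 ⟨hij.symm, hj⟩), Finset.mul_prod_erase _ (fun k : ℕ => tangentLine k) hi,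
    perturbedLines]

/-- No third line passes through the node: the line of slope `k` takes the value `(k - i)(k - j)`
there. -/
theorem eval_prod_tangentLine_ne_zero (s : Finset ℕ) (i j : ℕ) :
    eval ![(i : ℝ) + j, i * j] (∏ k ∈ (s.erase i).erase j, tangentLine k) ≠ 0 := by
  rw [map_prod, Finset.prod_ne_zero_iff]
  intro k hk
  rw [Finset.mem_erase, Finset.mem_erase] at hk
  rw [eval_tangentLine]
  have h1 : (k : ℝ) - i ≠ 0 := sub_ne_zero.2 (by exact_mod_cast hk.2.1)
  have h2 : (k : ℝ) - j ≠ 0 := sub_ne_zero.2 (by exact_mod_cast hk.1)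
  have : (k - i : ℝ) * (k - j) ≠ 0 := mul_ne_zero h1 h2
  convert this using 1
  simp only [Matrix.cons_val_zero, Matrix.cons_val_one]
  ring

/-- The ordinate at which the normal at the node `(i + j, i * j)` to the line of slope `i` meets
the line `x = c`. -/
noncomputable def normalHeight (c : ℝ) (a : ℕ × ℕ) : ℝ :=
  (a.1 : ℝ) * a.2 + ((a.1 : ℝ) + a.2 - c) / a.1

/-- Normals with different `i` have different slopes and meet at rational abscissae; those with the
same `i` are parallel and distinct. -/
theorem normalHeight_injOn {c : ℝ} (hc : Irrational c) :
    Set.InjOn (normalHeight c) {a | a.1 ≠ 0} := by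
  rintro ⟨i, j⟩ hi ⟨k, l⟩ hk h
  have hi' : (i : ℝ) ≠ 0 := by exact_mod_cast hi
  have hk' : (k : ℝ) ≠ 0 := by exact_mod_cast hk
  simp only [normalHeight] at h
  field_simp at h
  have hik : i = k := by
    by_contra hne
    have hne' : (i : ℤ) - k ≠ 0 := sub_ne_zero.2 (by exact_mod_cast hne)
    refine (hc.mul_intCast hne').ne_int
      (i * (k ^ 2 * l + k + l) - k * (i ^ 2 * j + i + j) : ℤ) ?_
    push_cast
    linear_combination h
  subst hik
  have h' : (i : ℝ) * (i ^ 2 + 1) * (j - l) = 0 := by linear_combination h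
  have hjl : (j : ℝ) - l = 0 := (mul_eq_zero.1 h').resolve_left (by positivity)
  have : j = l := by exact_mod_cast sub_eq_zero.1 hjl
  rw [this]

theorem card_mul_pred_le_maxRealDegreeEvolute (d : ℕ) (hd : 1 ≤ d) :
    ((d * d - d : ℕ) : ℕ∞) ≤ maxRealDegreeEvolute d := by
  set c₀ : ℝ := √2
  have hc₀ : Irrational c₀ := irrational_sqrt_two
  set A := (Finset.Icc 1 d).offDiag with hA
  have hA1 : ∀ a ∈ A, a.1 ∈ Finset.Icc 1 d ∧ a.2 ∈ Finset.Icc 1 d ∧ a.1 ≠ a.2 := fun a ha =>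
    Finset.mem_offDiag.1 ha
  have hAne : ∀ a ∈ A, a.1 ≠ 0 := fun a ha => by
    have := (Finset.mem_Icc.1 (hA1 a ha).1).1
    omega
  -- With this `δ` the intervals of radius `δ` around the heights are disjoint, so centres from
  -- different ordered pairs are distinct.
  obtain ⟨δ, hδ, hδA⟩ : ∃ δ : ℝ, 0 < δ ∧ ∀ ab ∈ A.offDiag,
      2 * δ < |normalHeight c₀ ab.1 - normalHeight c₀ ab.2| := by
    have hev : ∀ᶠ δ in 𝓝[>] (0 : ℝ), ∀ ab ∈ A.offDiag,
        2 * δ < |normalHeight c₀ ab.1 - normalHeight c₀ ab.2| := by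
      refine (Filter.eventually_all_finset _).2 fun ab hab => ?_
      obtain ⟨ha, hb, hne⟩ := Finset.mem_offDiag.1 hab
      have hpos : 2 * (0 : ℝ) < |normalHeight c₀ ab.1 - normalHeight c₀ ab.2| := by
        rw [mul_zero, abs_pos, sub_ne_zero]
        exact fun h => hne (normalHeight_injOn hc₀ (hAne _ ha) (hAne _ hb) h)
      exact nhdsWithin_le_nhds
        ((continuous_const.mul continuous_id).continuousAt.eventually_lt continuousAt_const hpos)
    obtain ⟨δ, h1, h2⟩ := (hev.and self_mem_nhdsWithin).exists
    exact ⟨δ, h2, h1⟩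
  have hev : ∀ᶠ w : ℝ × ℝ in 𝓝 c₀ ×ˢ 𝓝 0, ∀ a ∈ A, w.2 ≠ 0 → ∃ p,
      eval p (perturbedLines d (w.2 ^ 3)) = 0 ∧ curvatureForm (perturbedLines d (w.2 ^ 3)) p ≠ 0 ∧
      curvatureCentre (perturbedLines d (w.2 ^ 3)) p 0 = w.1 ∧
      |curvatureCentre (perturbedLines d (w.2 ^ 3)) p 1 - normalHeight c₀ a| < δ := by
    rw [← nhds_prod_eq]
    refine (Filter.eventually_all_finset _).2 fun a ha => ?_
    obtain ⟨h1, h2, h3⟩ := hA1 a ha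
    have := eventually_exists_curvatureCentre (i := a.1) (j := a.2) (by exact_mod_cast h3)
      (by exact_mod_cast hAne a ha) (eval_prod_tangentLine_ne_zero (Finset.Icc 1 d) a.1 a.2)
      (by exact_mod_cast hc₀.ne_nat (a.1 + a.2)) hδ
    simp only [perturbedLines_eq h1 h2 h3]
    exact this
  -- Separating the two variables fixes the curve first, through `η`; the abscissa `c` can then
  -- avoid the finitely many non-transversal lines of that curve's evolute.
  obtain ⟨u, hu, v, hv, huv⟩ := Filter.eventually_prod_iff.1 hev
  obtain ⟨η, ⟨hη, hη1⟩, hη0⟩ := (((hv.and (Iio_mem_nhds one_pos)).filter_mono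
    (nhdsWithin_le_nhds (s := Set.Ioi 0))).and self_mem_nhdsWithin).exists
  replace hη0 : 0 < η := hη0
  replace hη1 : η < 1 := hη1
  set f := perturbedLines d (η ^ 3) with hf
  set Γ : Set (Fin 2 → ℝ) := {p | eval p f = 0} with hΓ
  have hfΓ : IsEquationOf f Γ :=
    isEquationOf_perturbedLines d hd (by positivity) (pow_lt_one₀ hη0.le hη1 three_ne_zero)
  have hne : vanishingIdeal ℝ (curvatureCentres Γ) ≠ ⊥ := by
    obtain ⟨g, hg, hgd, hge⟩ := exists_monic_perturbedLines d hd (η ^ 3)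
    exact vanishingIdeal_curvatureCentres_ne_bot hg (hgd ▸ hd) (hge ▸ hfΓ)
  obtain ⟨c, hcu, hct⟩ := ((infinite_of_mem_nhds c₀ hu).sdiff
    (finite_not_meetsTransversally_verticalLine _ hne)).nonempty
  have htrans : MeetsTransversally (verticalLine c) (evolute Γ) := not_not.1 hct
  choose! p hp0 hpD hpc hph using fun a ha => huv hcu hη a ha hη0.ne'
  refine le_iSup_of_le Γ (le_iSup_of_le ⟨f, hfΓ, totalDegree_perturbedLines d _⟩
    (le_iSup_of_le (verticalLine c) (le_iSup_of_le (finrank_direction_verticalLine c)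
      (le_iSup_of_le htrans ?_))))
  have hinj : Set.InjOn (fun a => curvatureCentre f (p a)) (A : Set (ℕ × ℕ)) := by
    intro a ha b hb hab
    by_contra hne
    have h1 := hδA (a, b) (Finset.mem_offDiag.2 ⟨ha, hb, hne⟩)
    have h2 := abs_lt.1 (hph a ha)
    have h3 := abs_lt.1 (hph b hb)
    rw [show curvatureCentre (perturbedLines d (η ^ 3)) (p a) = _ from hab] at h2
    rcases lt_abs.1 h1 with h | h <;> simp only at h <;> linarith [h2.1, h2.2, h3.1, h3.2]
  calc ((d * d - d : ℕ) : ℕ∞) = ((A.image fun a => curvatureCentre f (p a)).card : ℕ∞) := by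
        rw [Finset.card_image_of_injOn hinj, hA, Finset.offDiag_card, Nat.card_Icc,
          Nat.add_sub_cancel]
    _ = ((A.image fun a => curvatureCentre f (p a) : Finset (Fin 2 → ℝ)) :
          Set (Fin 2 → ℝ)).encard := (Set.encard_coe_eq_coe_finsetCard _).symm
    _ ≤ _ := by
        refine Set.encard_le_encard fun q hq => ?_
        obtain ⟨a, ha, rfl⟩ := Finset.mem_image.1 (Finset.mem_coe.1 hq)
        exact ⟨zeroLocus_vanishingIdeal_le _ ⟨f, hfΓ, p a, hp0 a ha, hpD a ha, rfl⟩,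
          mem_verticalLine.2 (hpc a ha)⟩

theorem mainTheorem3 (d : ℕ) (hd : 3 ≤ d) :
    ((d * (d - 2) : ℕ) : ℕ∞) ≤ maxRealDegreeEvolute d := by
  refine le_trans ?_ (card_mul_pred_le_maxRealDegreeEvolute d (by omega))
  rw [Nat.cast_le, Nat.mul_sub]
  exact Nat.sub_le_sub_left (by omega) _
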